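/- Let $T$ be a complete consistent (possibly many-sorted) first-order theory and work in a big (sufficiently saturated and strongly homogeneous) model of $T$; $A,B,C,D,\dots$ denote small subsets of it, all cardinals mentioned are small, $AB=A\cup B$, and $A'\equiv_{C}A$ means that some automorphism of the big model fixes $C$ pointwise and maps the set $A$ onto $A'$. (Concretely: let $\bar\kappa=\beth_{\bar\kappa}$ be a fixed point of the beth function greater than the cardinality of the signature, let the big model be $\bar\kappa$-saturated and strongly $\bar\kappa$-homogeneous, and let "small" mean "of cardinality $<\bar\kappa$".) A ternary relation $A\perp_C B$ on small sets is an independence relation if it satisfies: (invariance) if $A\perp_CB$ and an automorphism maps $(A,B,C)$ to $(A',B',C')$, then $A'\perp_{C'}B'$; (monotonicity) if $A\perp_CB$, $A'\subseteq A$, $B'\subseteq B$, then $A'\perp_CB'$; (base monotonicity) if $D\subseteq C\subseteq B$ and $A\perp_DB$, then $A\perp_CB$; (transitivity) if $D\subseteq C\subseteq B$, $B\perp_CA$ and $C\perp_DA$, then $B\perp_DA$; (normality) $A\perp_CB$ implies $AC\perp_CB$; (extension) if $A\perp_CB$ and $\hat B\supseteq B$, there is $A'\equiv_{BC}A$ with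 $A'\perp_C\hat B$; (finite character) if $A_0\perp_CB$ for all finite $A_0\subseteq A$, then $A\perp_CB$; (local character) for every $A$ there is a cardinal $\kappa(A)$ such that for every $B$ there is $C\subseteq B$ with $|C|<\kappa(A)$ and $A\perp_CB$. It is strict if moreover $a\perp_Ba$ implies $a\in\operatorname{acl}B$ for every element $a$. It is canonical if it is strict and has the intersection property: if $C_1,C_2\subseteq B$, $A\perp_{C_1}B$ and $A\perp_{C_2}B$, then $A\perp_{\operatorname{acl}C_1\cap\operatorname{acl}C_2}B$. Write $A\perp^{M}_CB$ if $\operatorname{acl}(AC')\cap\operatorname{acl}(BC')=\operatorname{acl}C'$ for every $C'$ with $C\subseteq C'\subseteq\operatorname{acl}(BC)$. Thorn-forking independence is defined by: $A\perp^{\mathrm{th}}_CB$ if and only if for every $\hat B\supseteq B$ there is $A'\equiv_{BC}A$ with $A'\perp^{M}_C\hat B$. Theorem. If $\perp$ is a canonical independence relation, then $\perp=\perp^{\mathrm{th}}$; that is, for all small $A,B,C$ one has $A\perp_CB$ if and only if $A\perp^{\mathrm{th}}_CB$. -/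

import Mathlib

open Cardinal

universe u

/-! ### Many-sorted first-order logic -/

/-- A (possibly many-sorted) first-order signature. A function symbol `f` takes arguments in the
list of sorts `dom f` and has values in the sort `cod f`; a relation symbol `R` takes arguments in
the list of sorts `ar R`. One-sorted signatures are those with `Sorts := PUnit`. -/
structure SortedLanguage where
  Sorts : Type u
  Functions : Type u
  dom : Functions → List Sorts
  cod : Functions → Sorts
  Relations : Type u
  ar : Relations → List Sorts

namespace SortedLanguage

variable {L : SortedLanguage.{u}}

/-- Terms of a given sort, with variables indexed by `α`, where `σ i` is the sort of the
variable `i`. -/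
inductive Term (L : SortedLanguage.{u}) {α : Type u} (σ : α → L.Sorts) : L.Sorts → Type u
  | var (i : α) : Term L σ (σ i)
  | app (f : L.Functions) (ts : ∀ i : Fin (L.dom f).length, Term L σ ((L.dom f).get i)) :
      Term L σ (L.cod f)

/-- First-order formulas with free variables indexed by `α` (of sorts `σ`) and a list `Γ` of sorts
of additional variables in the scope of which we are working (de Bruijn style; `all s` binds a
new variable of sort `s`, put at the head of the list). -/
inductive BoundedFormula (L : SortedLanguage.{u}) {α : Type u} (σ : α → L.Sorts) :
    List L.Sorts → Type u
  | falsum {Γ : List L.Sorts} : BoundedFormula L σ Γ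
  | equal {Γ : List L.Sorts} {s : L.Sorts}
      (t₁ t₂ : Term L (α := α ⊕ Fin Γ.length)
        (Sum.elim σ Γ.get) s) : BoundedFormula L σ Γ
  | rel {Γ : List L.Sorts} (R : L.Relations)
      (ts : ∀ i : Fin (L.ar R).length,
        Term L (α := α ⊕ Fin Γ.length)
          (Sum.elim σ Γ.get) ((L.ar R).get i)) : BoundedFormula L σ Γ
  | imp {Γ : List L.Sorts} (φ ψ : BoundedFormula L σ Γ) : BoundedFormula L σ Γ
  | all {Γ : List L.Sorts} (s : L.Sorts) (φ : BoundedFormula L σ (s :: Γ)) : BoundedFormula L σ Γ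

/-- First-order formulas with free variables indexed by `α`, of sorts `σ`. -/
abbrev Formula (L : SortedLanguage.{u}) {α : Type u} (σ : α → L.Sorts) : Type u :=
  BoundedFormula L σ []

end SortedLanguage

/-- A structure for a many-sorted signature. -/
structure SortedStructure (L : SortedLanguage.{u}) where
  carrier : L.Sorts → Type u
  funMap : ∀ f : L.Functions,
    (∀ i : Fin (L.dom f).length, carrier ((L.dom f).get i)) → carrier (L.cod f)
  relMap : ∀ R : L.Relations,
    (∀ i : Fin (L.ar R).length, carrier ((L.ar R).get i)) → Prop

namespace SortedStructure

open SortedLanguage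

variable {L : SortedLanguage.{u}} (M : SortedStructure L)

/-- Joins two assignments of values to variables. -/
def join {α : Type u} {β : Type*} {σ : α → L.Sorts} {τ : β → L.Sorts}
    (v : ∀ i, M.carrier (σ i)) (w : ∀ j, M.carrier (τ j)) :
    ∀ k : α ⊕ β, M.carrier (Sum.elim σ τ k)
  | Sum.inl i => v i
  | Sum.inr j => w j

/-- The value of a term. -/
def eval {α : Type u} {σ : α → L.Sorts} (v : ∀ i, M.carrier (σ i)) :
    ∀ {s : L.Sorts}, Term L σ s → M.carrier s
  | _, .var i => v i
  | _, .app f ts => M.funMap f (fun i => eval v (ts i))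

/-- Tarski's truth definition. -/
def Realize {α : Type u} {σ : α → L.Sorts} (v : ∀ i, M.carrier (σ i)) :
    ∀ {Γ : List L.Sorts}, BoundedFormula L σ Γ →
      (∀ i : Fin Γ.length, M.carrier (Γ.get i)) → Prop
  | _, .falsum, _ => False
  | _, .equal t₁ t₂, xs => M.eval (M.join v xs) t₁ = M.eval (M.join v xs) t₂
  | _, .rel R ts, xs => M.relMap R (fun i => M.eval (M.join v xs) (ts i))
  | _, .imp φ ψ, xs => Realize v φ xs → Realize v ψ xs
  | Γ, .all s φ, xs => ∀ x : M.carrier s,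
      Realize v φ (Fin.cons (α := fun i => M.carrier ((s :: Γ).get i)) x xs)

/-- `M ⊨ φ(v)`. -/
def Sat {α : Type u} {σ : α → L.Sorts} (φ : Formula L σ) (v : ∀ i, M.carrier (σ i)) : Prop :=
  M.Realize v φ (fun i => i.elim0)

/-- The elements of the structure, of all sorts. Sets of elements are `Set M.Elem`. -/
abbrev Elem : Type u := Σ s : L.Sorts, M.carrier s

/-- Automorphisms of a many-sorted structure. -/
structure Auto where
  toEquiv : ∀ s : L.Sorts, M.carrier s ≃ M.carrier s
  map_fun : ∀ (f : L.Functions) (x : ∀ i : Fin (L.dom f).length, M.carrier ((L.dom f).get i)),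
    toEquiv _ (M.funMap f x) = M.funMap f (fun i => toEquiv _ (x i))
  map_rel : ∀ (R : L.Relations) (x : ∀ i : Fin (L.ar R).length, M.carrier ((L.ar R).get i)),
    M.relMap R (fun i => toEquiv _ (x i)) ↔ M.relMap R x

variable {M} in
/-- The action of an automorphism on elements. -/
def Auto.act (g : M.Auto) (a : M.Elem) : M.Elem := ⟨a.1, g.toEquiv a.1 a.2⟩

variable {M} in
/-- The automorphism `g` fixes the set `B` pointwise. -/
def Auto.Fixes (g : M.Auto) (B : Set M.Elem) : Prop := ∀ b ∈ B, g.act b = b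

/-- Algebraic closure: `a ∈ acl B` iff `a` satisfies a formula with parameters in `B` which has only
finitely many solutions. -/
def acl (B : Set M.Elem) : Set M.Elem :=
  {a | ∃ φ : Formula L (α := B ⊕ PUnit.{u + 1})
        (Sum.elim (fun b => b.1.1) (fun _ => a.1)),
      M.Sat φ (M.join (fun b => b.1.2) (fun _ => a.2)) ∧
      {x : M.carrier a.1 | M.Sat φ (M.join (fun b => b.1.2) (fun _ => x))}.Finite}

/-- `κ`-saturation: if `a` is a tuple of fewer than `κ` parameters and `p` is a set of formulas over
`a` in fewer than `κ` variables which is finitely satisfiable, then `p` is realised. -/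
def IsSaturated (κ : Cardinal.{u}) : Prop :=
  ∀ (α β : Type u), #α < κ → #β < κ →
  ∀ (σ : α → L.Sorts) (τ : β → L.Sorts) (a : ∀ i, M.carrier (σ i))
    (p : Set (Formula L (Sum.elim σ τ))),
    (∀ q : Set (Formula L (Sum.elim σ τ)), q ⊆ p → q.Finite →
      ∃ y : ∀ j, M.carrier (τ j), ∀ φ ∈ q, M.Sat φ (M.join a y)) →
    ∃ y : ∀ j, M.carrier (τ j), ∀ φ ∈ p, M.Sat φ (M.join a y)

/-- Strong `κ`-homogeneity: two tuples of the same length `< κ` with the same complete type are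
conjugate under an automorphism. -/
def IsStronglyHomogeneous (κ : Cardinal.{u}) : Prop :=
  ∀ (α : Type u), #α < κ →
  ∀ (σ : α → L.Sorts) (a b : ∀ i, M.carrier (σ i)),
    (∀ φ : Formula L σ, M.Sat φ a ↔ M.Sat φ b) →
    ∃ g : M.Auto, ∀ i, g.toEquiv (σ i) (a i) = b i

/-- `M` is a big (monster) model of its complete theory, where a set is small if its
cardinality is `< κ`. The cardinal `κ` is a fixed point of the beth function (e.g. an inaccessible
cardinal; but such fixed points exist above every cardinal), so that all cardinals obtained from
small ones by the usual operations, such as those in the Erdős–Rado theorem, are small; the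
signature is small. -/
structure IsBigModel (κ : Cardinal.{u}) : Prop where
  beth_fixed : Cardinal.beth κ.ord = κ
  sorts_small : #L.Sorts < κ
  functions_small : #L.Functions < κ
  relations_small : #L.Relations < κ
  saturated : M.IsSaturated κ
  homogeneous : M.IsStronglyHomogeneous κ

/-! ### Independence relations

A ternary relation `ind` on sets of elements is written `ind A C B` for "`A` is independent
from `B` over `C`". Only its values on small sets matter. -/

/-- The axioms for independence relations, on the small subsets of `M`. -/
structure IsIndependenceRelation (κ : Cardinal.{u})
    (ind : Set M.Elem → Set M.Elem → Set M.Elem → Prop) : Prop where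
  invariance : ∀ A B C : Set M.Elem, #A < κ → #B < κ → #C < κ → ∀ g : M.Auto,
    ind A C B → ind (g.act '' A) (g.act '' C) (g.act '' B)
  monotonicity : ∀ A B C A' B' : Set M.Elem, #A < κ → #B < κ → #C < κ →
    ind A C B → A' ⊆ A → B' ⊆ B → ind A' C B'
  base_monotonicity : ∀ A B C D : Set M.Elem, #A < κ → #B < κ →
    D ⊆ C → C ⊆ B → ind A D B → ind A C B
  transitivity : ∀ A B C D : Set M.Elem, #A < κ → #B < κ →
    D ⊆ C → C ⊆ B → ind B C A → ind C D A → ind B D A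
  normality : ∀ A B C : Set M.Elem, #A < κ → #B < κ → #C < κ →
    ind A C B → ind (A ∪ C) C B
  extension : ∀ A B C B' : Set M.Elem, #A < κ → #B < κ → #C < κ → #B' < κ →
    ind A C B → B ⊆ B' → ∃ g : M.Auto, g.Fixes (B ∪ C) ∧ ind (g.act '' A) C B'
  finite_character : ∀ A B C : Set M.Elem, #A < κ → #B < κ → #C < κ →
    (∀ A₀ : Set M.Elem, A₀ ⊆ A → A₀.Finite → ind A₀ C B) → ind A C B
  local_character : ∀ A : Set M.Elem, #A < κ → ∃ μ : Cardinal.{u}, μ < κ ∧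
    ∀ B : Set M.Elem, #B < κ → ∃ C : Set M.Elem, C ⊆ B ∧ #C < μ ∧ ind A C B

/-- Strict independence relations: those which are anti-reflexive. -/
structure IsStrictIndependenceRelation (κ : Cardinal.{u})
    (ind : Set M.Elem → Set M.Elem → Set M.Elem → Prop) : Prop
    extends M.IsIndependenceRelation κ ind where
  anti_reflexivity : ∀ (a : M.Elem) (B : Set M.Elem), #B < κ → ind {a} B {a} → a ∈ M.acl B

/-- Canonical independence relations: strict ones with the intersection property. -/
structure IsCanonicalIndependenceRelation (κ : Cardinal.{u})
    (ind : Set M.Elem → Set M.Elem → Set M.Elem → Prop) : Prop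
    extends M.IsStrictIndependenceRelation κ ind where
  intersection : ∀ A B C₁ C₂ : Set M.Elem, #A < κ → #B < κ → C₁ ⊆ B → C₂ ⊆ B →
    ind A C₁ B → ind A C₂ B → ind A (M.acl C₁ ∩ M.acl C₂) B

/-- M-dividing independence of `A` from `B` over `C`. -/
def MIndep (A C B : Set M.Elem) : Prop :=
  ∀ C' : Set M.Elem, C ⊆ C' → C' ⊆ M.acl (B ∪ C) →
    M.acl (A ∪ C') ∩ M.acl (B ∪ C') = M.acl C'

/-- Thorn-forking independence of `A` from `B` over `C`: for every small `B' ⊇ B` there is a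
conjugate `A'` of `A` over `B ∪ C` which is M-dividing independent from `B'` over `C`. -/
def ThornIndep (κ : Cardinal.{u}) (A C B : Set M.Elem) : Prop :=
  ∀ B' : Set M.Elem, #B' < κ → B ⊆ B' →
    ∃ g : M.Auto, g.Fixes (B ∪ C) ∧ M.MIndep (g.act '' A) C B'

end SortedStructure

/-! Strictness alone gives one direction: if `ind A C B`, then the right side may be enlarged to
`acl (B ∪ C)`, the base raised to any intermediate `C'`, and the left side closed to `acl (A ∪ C')`;
an element common to both sides is then independent from itself over `C'`, hence lies in `acl C'`.
Extension turns this M-independence into thorn-independence.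

For the converse, write `P = B ∪ C` and let μ bound the local character of `A` and of `P`. Choose a
small set `H ⊇ P`, a union of copies of `A`, rich enough to contain certain sequences of length ρ =
μ⁺ (`exists_saturated_family`). Thorn-independence gives a conjugate `A*` of `A` over `P` which is
M-independent from `H` over `C`. Local character gives `ind A* D H`, where `D` is `P` together with
at most μ copies of `A`, so that `D` still has local character bounded by μ (`localBound_iUnion`).
Inside `H` take sets `Y i`, for `i < ρ`, each realising the type of `A*` over `D` and the earlier `Y
j`. M-independence, peeled off one `Y i` at a time, yields `acl D ∩ acl (C ∪ ⋃ Y) = acl C`. Local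
character of `D`, with regularity of ρ, gives an initial part `E` of the sequence, containing `C`,
over which `D` is independent from the next term `Y i`. By symmetry `Y i` is independent from `D ∪
E` over `E`; by transfer from `A*` it is also independent over `D`. The intersection property brings
the base down to `acl D ∩ acl E = acl C`, and `Y i` is a conjugate of `A` over `P`.

Symmetry is not an axiom (`IsIndependenceRelation.symm`). It comes from Morley sequences in reversed
order, obtained by stretching a long Morley sequence by means of an Erdős–Rado argument and
compactness; local character then places a base inside the part of the sequence preceding some term.
-/

/-! ### Substitution and finite support of formulas -/

namespace SortedLanguage

variable {L : SortedLanguage.{u}} {α β : Type u} {σ : α → L.Sorts} {τ : β → L.Sorts}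

/-- Substitution of terms for the variables of a term. -/
def Term.subst (f : ∀ i, Term L τ (σ i)) : ∀ {s : L.Sorts}, Term L σ s → Term L τ s
  | _, .var i => f i
  | _, .app F ts => .app F (fun i => (ts i).subst f)

/-- A substitution, extended by the identity on the bound variables. -/
def liftSubst (f : ∀ i, Term L τ (σ i)) (Γ : List L.Sorts) :
    ∀ k : α ⊕ Fin Γ.length, Term L (Sum.elim τ Γ.get) (Sum.elim σ Γ.get k)
  | .inl i => (f i).subst (fun j => Term.var (σ := Sum.elim τ Γ.get) (Sum.inl j))
  | .inr k => Term.var (σ := Sum.elim τ Γ.get) (Sum.inr k)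

/-- Substitution of terms for the free variables of a formula. -/
def BoundedFormula.subst (f : ∀ i, Term L τ (σ i)) :
    ∀ {Γ : List L.Sorts}, BoundedFormula L σ Γ → BoundedFormula L τ Γ
  | _, .falsum => .falsum
  | Γ, .equal t₁ t₂ => .equal (t₁.subst (liftSubst f Γ)) (t₂.subst (liftSubst f Γ))
  | Γ, .rel R ts => .rel R (fun i => (ts i).subst (liftSubst f Γ))
  | _, .imp φ ψ => .imp (φ.subst f) (ψ.subst f)
  | _, .all s φ => .all s (φ.subst f)

/-- Negation. -/
def BoundedFormula.not {Γ : List L.Sorts} (φ : BoundedFormula L σ Γ) : BoundedFormula L σ Γ :=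
  .imp φ .falsum

/-- Conjunction. -/
def BoundedFormula.and {Γ : List L.Sorts} (φ ψ : BoundedFormula L σ Γ) : BoundedFormula L σ Γ :=
  (φ.imp ψ.not).not

end SortedLanguage

namespace SortedStructure

open SortedLanguage

variable {L : SortedLanguage.{u}} {M : SortedStructure L}
variable {α β : Type u} {σ : α → L.Sorts} {τ : β → L.Sorts}

theorem eval_subst (f : ∀ i, Term L τ (σ i)) (w : ∀ j, M.carrier (τ j)) {s : L.Sorts}
    (t : Term L σ s) : M.eval w (t.subst f) = M.eval (fun i => M.eval w (f i)) t := by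
  induction t with
  | var i => rfl
  | app F ts ih => simp only [Term.subst, eval, ih]

theorem eval_liftSubst (f : ∀ i, Term L τ (σ i)) (w : ∀ j, M.carrier (τ j)) (Γ : List L.Sorts)
    (xs : ∀ i : Fin Γ.length, M.carrier (Γ.get i)) :
    (fun k => M.eval (M.join w xs) (liftSubst f Γ k)) =
      M.join (fun i => M.eval w (f i)) xs := by
  funext k
  rcases k with i | k
  · exact eval_subst _ _ _
  · rfl

theorem realize_subst (f : ∀ i, Term L τ (σ i)) (w : ∀ j, M.carrier (τ j)) {Γ : List L.Sorts}
    (φ : BoundedFormula L σ Γ) (xs : ∀ i : Fin Γ.length, M.carrier (Γ.get i)) :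
    M.Realize w (φ.subst f) xs ↔ M.Realize (fun i => M.eval w (f i)) φ xs := by
  induction φ with
  | falsum => rfl
  | equal t₁ t₂ => simp only [BoundedFormula.subst, Realize, eval_subst, eval_liftSubst]
  | rel R ts => simp only [BoundedFormula.subst, Realize, eval_subst, eval_liftSubst]
  | imp φ ψ h₁ h₂ => simp only [BoundedFormula.subst, Realize, h₁, h₂]
  | all s φ ih => simp only [BoundedFormula.subst, Realize, ih]

theorem sat_subst (f : ∀ i, Term L τ (σ i)) (w : ∀ j, M.carrier (τ j)) (φ : Formula L σ) :
    M.Sat (φ.subst f) w ↔ M.Sat φ (fun i => M.eval w (f i)) :=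
  realize_subst f w φ _

theorem sat_not (φ : Formula L σ) (v : ∀ i, M.carrier (σ i)) :
    M.Sat φ.not v ↔ ¬ M.Sat φ v := Iff.rfl

theorem sat_and (φ ψ : Formula L σ) (v : ∀ i, M.carrier (σ i)) :
    M.Sat (φ.and ψ) v ↔ M.Sat φ v ∧ M.Sat ψ v := by
  change ¬ (M.Sat φ v → ¬ M.Sat ψ v) ↔ _
  tauto

/-- A formula expressing the equality of two variables of the same sort. -/
theorem exists_sat_iff_eq {i j : α} (h : σ j = σ i) :
    ∃ φ : Formula L σ, ∀ v : ∀ i, M.carrier (σ i), M.Sat φ v ↔ h ▸ v j = v i := by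
  -- The variable `j` is generalised to a term of an arbitrary sort `s`, so that the equation
  -- between sorts can be eliminated.
  have key : ∀ s (t : Term L σ s) (h : s = σ i), ∃ φ : Formula L σ,
      ∀ v : ∀ i, M.carrier (σ i), M.Sat φ v ↔ h ▸ M.eval v t = v i := by
    intro s t h
    subst h
    refine ⟨.equal (t.subst fun j => Term.var (σ := Sum.elim σ _) (Sum.inl j))
      (Term.var (σ := Sum.elim σ _) (Sum.inl i)), fun v => ?_⟩
    have h₁ := eval_subst (M := M) (τ := Sum.elim σ ([] : List L.Sorts).get)
      (fun j => Term.var (σ := Sum.elim σ ([] : List L.Sorts).get) (Sum.inl j))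
      (M.join v fun i => i.elim0) t
    change M.eval _ _ = v i ↔ M.eval v t = v i
    exact Eq.congr_left h₁
  exact key _ (Term.var j) h

/-- A term has finitely many variables: it is enough to substitute for those. -/
theorem Term.exists_finite_support {s : L.Sorts} (t : Term L σ s) :
    ∃ S : Set α, S.Finite ∧ ∀ {β : Type u} {τ : β → L.Sorts} (f : ∀ i ∈ S, Term L τ (σ i)),
      ∃ t' : Term L τ s, ∀ (v : ∀ i, M.carrier (σ i)) (w : ∀ j, M.carrier (τ j)),
        (∀ i (hi : i ∈ S), M.eval w (f i hi) = v i) → M.eval w t' = M.eval v t := by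
  induction t with
  | var i =>
    exact ⟨{i}, Set.finite_singleton i, fun f => ⟨f i rfl, fun v w h => h i rfl⟩⟩
  | app F ts ih =>
    choose S hS h using ih
    refine ⟨⋃ i, S i, Set.finite_iUnion hS, fun {β τ} f => ?_⟩
    choose ts' hts using fun i => h i (fun j hj => f j (Set.mem_iUnion_of_mem i hj))
    refine ⟨.app F ts', fun v w hvw => ?_⟩
    simp only [eval]
    congr 1
    funext i
    exact hts i v w fun j hj => hvw j _

/-- Bound variables are carried to themselves, so only the free ones count for the support. The
substitution is prescribed only on the support because outside it a term of the required sort need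
not exist. -/
theorem Term.exists_finite_support_join {Γ : List L.Sorts} {s : L.Sorts}
    (t : Term L (Sum.elim σ Γ.get) s) :
    ∃ S : Set α, S.Finite ∧ ∀ {β : Type u} {τ : β → L.Sorts} (f : ∀ i ∈ S, Term L τ (σ i)),
      ∃ t' : Term L (Sum.elim τ Γ.get) s,
        ∀ (v : ∀ i, M.carrier (σ i)) (w : ∀ j, M.carrier (τ j))
          (xs : ∀ i : Fin Γ.length, M.carrier (Γ.get i)),
        (∀ i (hi : i ∈ S), M.eval w (f i hi) = v i) →
          M.eval (M.join w xs) t' = M.eval (M.join v xs) t := by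
  obtain ⟨S, hS, h⟩ := Term.exists_finite_support (M := M) t
  refine ⟨Sum.inl ⁻¹' S, hS.preimage Sum.inl_injective.injOn, fun {β τ} f => ?_⟩
  obtain ⟨t', ht'⟩ := h (τ := Sum.elim τ Γ.get) (fun i hi => match i, hi with
    | .inl i, hi => (f i hi).subst (fun j => Term.var (σ := Sum.elim τ Γ.get) (Sum.inl j))
    | .inr k, _ => Term.var (σ := Sum.elim τ Γ.get) (Sum.inr k))
  refine ⟨t', fun v w xs hvw => ht' _ _ fun i hi => ?_⟩
  rcases i with i | k
  · exact (eval_subst _ _ _).trans (hvw i hi)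
  · rfl

/-- A formula has finitely many free variables: it is enough to substitute for those. -/
theorem BoundedFormula.exists_finite_support {Γ : List L.Sorts} (φ : BoundedFormula L σ Γ) :
    ∃ S : Set α, S.Finite ∧ ∀ {β : Type u} {τ : β → L.Sorts} (f : ∀ i ∈ S, Term L τ (σ i)),
      ∃ φ' : BoundedFormula L τ Γ,
        ∀ (v : ∀ i, M.carrier (σ i)) (w : ∀ j, M.carrier (τ j))
          (xs : ∀ i : Fin Γ.length, M.carrier (Γ.get i)),
        (∀ i (hi : i ∈ S), M.eval w (f i hi) = v i) →
          (M.Realize w φ' xs ↔ M.Realize v φ xs) := by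
  induction φ with
  | falsum => exact ⟨∅, Set.finite_empty, fun f => ⟨.falsum, fun v w xs h => Iff.rfl⟩⟩
  | equal t₁ t₂ =>
    obtain ⟨S₁, hS₁, h₁⟩ := Term.exists_finite_support_join (M := M) t₁
    obtain ⟨S₂, hS₂, h₂⟩ := Term.exists_finite_support_join (M := M) t₂
    refine ⟨S₁ ∪ S₂, hS₁.union hS₂, fun f => ?_⟩
    obtain ⟨t₁', h₁⟩ := h₁ (fun i hi => f i (Or.inl hi))
    obtain ⟨t₂', h₂⟩ := h₂ (fun i hi => f i (Or.inr hi))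
    refine ⟨.equal t₁' t₂', fun v w xs h => ?_⟩
    simp only [Realize]
    rw [h₁ v w xs fun i hi => h i _, h₂ v w xs fun i hi => h i _]
  | rel R ts =>
    choose S hS h using fun i => Term.exists_finite_support_join (M := M) (ts i)
    refine ⟨⋃ i, S i, Set.finite_iUnion hS, fun {β τ} f => ?_⟩
    choose ts' hts using fun i => h i (fun j hj => f j (Set.mem_iUnion_of_mem i hj))
    refine ⟨.rel R ts', fun v w xs hvw => ?_⟩
    simp only [Realize]
    rw [funext fun i => hts i v w xs fun j hj => hvw j _]
  | imp φ ψ hφ hψ =>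
    obtain ⟨S₁, hS₁, h₁⟩ := hφ
    obtain ⟨S₂, hS₂, h₂⟩ := hψ
    refine ⟨S₁ ∪ S₂, hS₁.union hS₂, fun f => ?_⟩
    obtain ⟨φ', h₁⟩ := h₁ (fun i hi => f i (Or.inl hi))
    obtain ⟨ψ', h₂⟩ := h₂ (fun i hi => f i (Or.inr hi))
    refine ⟨.imp φ' ψ', fun v w xs h => ?_⟩
    simp only [Realize]
    rw [h₁ v w xs fun i hi => h i _, h₂ v w xs fun i hi => h i _]
  | all s φ ih =>
    obtain ⟨S, hS, h⟩ := ih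
    refine ⟨S, hS, fun f => ?_⟩
    obtain ⟨φ', h⟩ := h f
    refine ⟨.all s φ', fun v w xs hvw => ?_⟩
    simp only [Realize]
    exact forall_congr' fun x => h v w _ hvw

/-! ### Automorphisms -/

namespace Auto

/-- The identity automorphism. -/
def refl (M : SortedStructure L) : M.Auto where
  toEquiv _ := Equiv.refl _
  map_fun _ _ := rfl
  map_rel _ _ := Iff.rfl

/-- The composition `h ∘ g`. -/
def comp (h g : M.Auto) : M.Auto where
  toEquiv s := (g.toEquiv s).trans (h.toEquiv s)
  map_fun F x := by simp [g.map_fun, h.map_fun]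
  map_rel R x := (h.map_rel R fun i => g.toEquiv _ (x i)).trans (g.map_rel R x)

/-- The inverse automorphism. -/
def symm (g : M.Auto) : M.Auto where
  toEquiv s := (g.toEquiv s).symm
  map_fun F x := by
    rw [Equiv.symm_apply_eq, g.map_fun]
    simp
  map_rel R x := by
    rw [← g.map_rel]
    simp

@[simp] theorem act_comp (h g : M.Auto) (a : M.Elem) : (h.comp g).act a = h.act (g.act a) := rfl

@[simp] theorem act_symm_act (g : M.Auto) (a : M.Elem) : g.symm.act (g.act a) = a :=
  Sigma.ext rfl (heq_of_eq ((g.toEquiv a.1).symm_apply_apply a.2))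

@[simp] theorem act_act_symm (g : M.Auto) (a : M.Elem) : g.act (g.symm.act a) = a :=
  Sigma.ext rfl (heq_of_eq ((g.toEquiv a.1).apply_symm_apply a.2))

theorem act_injective (g : M.Auto) : Function.Injective g.act :=
  Function.LeftInverse.injective g.act_symm_act

theorem image_symm_image (g : M.Auto) (A : Set M.Elem) : g.symm.act '' (g.act '' A) = A := by
  simp [Set.image_image]

theorem image_image_symm (g : M.Auto) (A : Set M.Elem) : g.act '' (g.symm.act '' A) = A := by
  simp [Set.image_image]

theorem image_comp (h g : M.Auto) (A : Set M.Elem) :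
    (h.comp g).act '' A = h.act '' (g.act '' A) :=
  (Set.image_image h.act g.act A).symm

theorem Fixes.symm {g : M.Auto} {B : Set M.Elem} (h : g.Fixes B) : g.symm.Fixes B := fun b hb => by
  conv_lhs => rw [← h b hb]
  simp

theorem Fixes.comp {h g : M.Auto} {B : Set M.Elem} (hh : h.Fixes B) (hg : g.Fixes B) :
    (h.comp g).Fixes B := fun b hb => by
  rw [act_comp, hg b hb, hh b hb]

theorem Fixes.mono {g : M.Auto} {B B' : Set M.Elem} (h : g.Fixes B) (hB : B' ⊆ B) : g.Fixes B' :=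
  fun b hb => h b (hB hb)

theorem Fixes.image_eq {g : M.Auto} {B : Set M.Elem} (h : g.Fixes B) : g.act '' B = B := by
  ext b
  exact ⟨fun ⟨b', hb', e⟩ => e ▸ (h b' hb').symm ▸ hb', fun hb => ⟨b, hb, h b hb⟩⟩

theorem Fixes.act_eq {g : M.Auto} {B : Set M.Elem} (h : g.Fixes B) {s : L.Sorts} {x : M.carrier s}
    (hx : (⟨s, x⟩ : M.Elem) ∈ B) : g.toEquiv s x = x := by
  have := h _ hx
  simpa [act] using this

theorem mk_image (g : M.Auto) (A : Set M.Elem) : #(g.act '' A) = #A :=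
  Cardinal.mk_image_eq g.act_injective

end Auto

theorem eval_auto (g : M.Auto) (v : ∀ i, M.carrier (σ i)) {s : L.Sorts} (t : Term L σ s) :
    M.eval (fun i => g.toEquiv _ (v i)) t = g.toEquiv s (M.eval v t) := by
  induction t with
  | var i => rfl
  | app F ts ih => simp only [eval, ih, g.map_fun]

theorem join_auto (g : M.Auto) (v : ∀ i, M.carrier (σ i)) {β : Type*} {τ : β → L.Sorts}
    (w : ∀ j, M.carrier (τ j)) :
    M.join (fun i => g.toEquiv _ (v i)) (fun j => g.toEquiv _ (w j)) =
      fun k => g.toEquiv _ (M.join v w k) := by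
  funext k
  rcases k with i | j <;> rfl

theorem realize_auto (g : M.Auto) (v : ∀ i, M.carrier (σ i)) {Γ : List L.Sorts}
    (φ : BoundedFormula L σ Γ) (xs : ∀ i : Fin Γ.length, M.carrier (Γ.get i)) :
    M.Realize (fun i => g.toEquiv _ (v i)) φ (fun i => g.toEquiv _ (xs i)) ↔
      M.Realize v φ xs := by
  induction φ with
  | falsum => rfl
  | equal t₁ t₂ =>
    simp only [Realize, join_auto, eval_auto, EmbeddingLike.apply_eq_iff_eq]
  | rel R ts => simp only [Realize, join_auto, eval_auto, g.map_rel]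
  | imp φ ψ h₁ h₂ => simp only [Realize, h₁, h₂]
  | @all Γ s φ ih =>
    simp only [Realize]
    rw [← (g.toEquiv s).forall_congr_right]
    refine forall_congr' fun x => ?_
    rw [← ih]
    refine iff_of_eq (congrArg _ ?_)
    funext i
    refine Fin.cases ?_ (fun i => ?_) i <;> rfl

theorem sat_auto (g : M.Auto) (v : ∀ i, M.carrier (σ i)) (φ : Formula L σ) :
    M.Sat φ (fun i => g.toEquiv _ (v i)) ↔ M.Sat φ v := by
  unfold Sat
  rw [← realize_auto g v φ]
  refine iff_of_eq (congrArg _ ?_)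
  funext i
  exact i.elim0

end SortedStructure

/-! ### Counting formulas by their syntax trees -/

namespace SortedLanguage

variable {L : SortedLanguage.{u}} {α : Type u} {σ : α → L.Sorts} {V : Type u}

/-- The number of arguments of the nodes of the syntax tree of a term. -/
abbrev termArity (L : SortedLanguage.{u}) (V : Type u) : V ⊕ L.Functions → Type
  | .inl _ => Fin 0
  | .inr F => Fin (L.dom F).length

/-- The syntax tree of a term, with `n i` as the name of the variable `i`. -/
def Term.code (n : α → V) : ∀ {s : L.Sorts}, Term L σ s → WType (termArity L V)
  | _, .var i => ⟨.inl (n i), fun k => k.elim0⟩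
  | _, .app F ts => ⟨.inr F, fun i => (ts i).code n⟩

/-- Equality is stated for pairs with the sort because the induction compares terms whose sorts are
not known in advance to agree. -/
theorem Term.code_injective {n : α → V} (hn : Function.Injective n) {s s' : L.Sorts}
    (t : Term L σ s) (t' : Term L σ s') (h : t.code n = t'.code n) :
    (⟨s, t⟩ : Σ s, Term L σ s) = ⟨s', t'⟩ := by
  induction t generalizing s' with
  | var i =>
    cases t' with
    | var j =>
      simp only [Term.code, WType.mk.injEq, Sum.inl.injEq] at h
      obtain rfl := hn h.1
      rfl
    | app F ts => simp [Term.code] at h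
  | app F ts ih =>
    cases t' with
    | var j => simp [Term.code] at h
    | app F' ts' =>
      simp only [Term.code, WType.mk.injEq, Sum.inr.injEq] at h
      obtain ⟨rfl, h⟩ := h
      have h' : ts = ts' := by
        funext i
        have := ih i (ts' i) (congrFun (eq_of_heq h) i)
        exact eq_of_heq (Sigma.mk.inj this).2
      rw [h']

/-- Labels of the nodes of the syntax tree of a formula. -/
abbrev FormulaNode (L : SortedLanguage.{u}) (α : Type u) : Type u :=
  List L.Sorts × (PUnit.{u + 1} ⊕ (WType (termArity L (α ⊕ ℕ)) × WType (termArity L (α ⊕ ℕ))) ⊕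
    (L.Relations × List (WType (termArity L (α ⊕ ℕ)))) ⊕ PUnit.{u + 1} ⊕ L.Sorts)

/-- The number of subformulas at the nodes of the syntax tree of a formula. -/
abbrev formulaArity (L : SortedLanguage.{u}) (α : Type u) : FormulaNode L α → Type
  | (_, .inl _) => Fin 0
  | (_, .inr (.inl _)) => Fin 0
  | (_, .inr (.inr (.inl _))) => Fin 0
  | (_, .inr (.inr (.inr (.inl _)))) => Bool
  | (_, .inr (.inr (.inr (.inr _)))) => Unit

/-- The syntax tree of a formula. -/
def BoundedFormula.code : ∀ {Γ : List L.Sorts}, BoundedFormula L σ Γ → WType (formulaArity L α)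
  | Γ, .falsum => ⟨(Γ, .inl ⟨⟩), fun k => k.elim0⟩
  | Γ, .equal t₁ t₂ => ⟨(Γ, .inr (.inl (t₁.code (Sum.map id Fin.val), t₂.code (Sum.map id Fin.val)))),
      fun k => k.elim0⟩
  | Γ, .rel R ts => ⟨(Γ, .inr (.inr (.inl (R, List.ofFn fun i => (ts i).code (Sum.map id Fin.val))))),
      fun k => k.elim0⟩
  | Γ, .imp φ ψ => ⟨(Γ, .inr (.inr (.inr (.inl ⟨⟩)))), fun b => match b with
      | true => φ.code
      | false => ψ.code⟩
  | Γ, .all s φ => ⟨(Γ, .inr (.inr (.inr (.inr s)))), fun _ => φ.code⟩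

/-- The nodes record the context, and bound variables are named by natural numbers, so formulas in
different contexts share one type of codes. -/
theorem BoundedFormula.code_injective {Γ Γ' : List L.Sorts} (φ : BoundedFormula L σ Γ)
    (φ' : BoundedFormula L σ Γ') (h : φ.code = φ'.code) :
    (⟨Γ, φ⟩ : Σ Γ, BoundedFormula L σ Γ) = ⟨Γ', φ'⟩ := by
  have hn : ∀ n : ℕ, Function.Injective (Sum.map id Fin.val : α ⊕ Fin n → α ⊕ ℕ) := fun n =>
    Function.Injective.sumMap Function.injective_id Fin.val_injective
  induction φ generalizing Γ' with
  | falsum =>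
    cases φ' <;> simp [BoundedFormula.code] at h
    subst h
    rfl
  | equal t₁ t₂ =>
    cases φ' <;> simp [BoundedFormula.code] at h
    obtain ⟨rfl, h₁, h₂⟩ := h
    have e₁ := Term.code_injective (hn _) _ _ h₁
    have e₂ := Term.code_injective (hn _) _ _ h₂
    obtain ⟨rfl, e₁⟩ := Sigma.mk.inj e₁
    obtain rfl := eq_of_heq e₁
    obtain rfl := eq_of_heq (Sigma.mk.inj e₂).2
    rfl
  | rel R ts =>
    cases φ' <;> simp [BoundedFormula.code] at h
    obtain ⟨rfl, rfl, h⟩ := h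
    rename_i ts'
    replace h := List.ofFn_injective h
    have h' : ts = ts' := by
      funext i
      have := Term.code_injective (hn _) _ _ (congrFun h i)
      exact eq_of_heq (Sigma.mk.inj this).2
    rw [h']
  | imp φ ψ hφ hψ =>
    cases φ' <;> simp [BoundedFormula.code] at h
    obtain ⟨rfl, h⟩ := h
    have e₁ := hφ _ (congrFun h true)
    have e₂ := hψ _ (congrFun h false)
    obtain rfl := eq_of_heq (Sigma.mk.inj e₁).2
    obtain rfl := eq_of_heq (Sigma.mk.inj e₂).2
    rfl
  | all s φ ih =>
    cases φ' <;> simp [BoundedFormula.code] at h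
    obtain ⟨⟨rfl, rfl⟩, h⟩ := h
    have e₁ := ih _ (congrFun h ())
    obtain rfl := eq_of_heq (Sigma.mk.inj e₁).2
    rfl

/-- A W-type with finite arities and at most ν labels has at most ν elements when ν is infinite;
this is applied to terms and then to formulas. -/
theorem mk_formula_le {ν : Cardinal.{u}} (hν : ℵ₀ ≤ ν) (hα : #α ≤ ν) (hS : #L.Sorts ≤ ν)
    (hF : #L.Functions ≤ ν) (hR : #L.Relations ≤ ν) : #(Formula L σ) ≤ ν := by
  have hT : #(WType (termArity L (α ⊕ ℕ))) ≤ ν := by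
    have : ∀ a, Finite (termArity L (α ⊕ ℕ) a) := by
      rintro (a | a) <;> dsimp only [termArity] <;> infer_instance
    refine WType.cardinalMk_le_max_aleph0_of_finite'.trans (max_le ?_ hν)
    simp only [mk_sum, lift_id, lift_uzero, mk_eq_aleph0, lift_aleph0]
    exact add_le_of_le hν (add_le_of_le hν hα hν) hF
  have hL : ∀ T : Type u, #T ≤ ν → #(List T) ≤ ν := fun T h =>
    (mk_list_le_max T).trans (max_le hν h)
  have hN : #(FormulaNode L α) ≤ ν := by
    have h1 : (1 : Cardinal.{u}) ≤ ν := one_le_aleph0.trans hν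
    simp only [mk_prod, mk_sum, lift_id, mk_punit]
    exact mul_le_of_le hν (hL _ hS) (add_le_of_le hν h1 (add_le_of_le hν (mul_le_of_le hν hT hT)
      (add_le_of_le hν (mul_le_of_le hν hR (hL _ hT)) (add_le_of_le hν h1 hS))))
  have hW : #(WType (formulaArity L α)) ≤ ν := by
    have : ∀ a, Finite (formulaArity L α a) := by
      rintro ⟨Γ, (a | a | a | a | a)⟩ <;> dsimp only [formulaArity] <;> infer_instance
    refine WType.cardinalMk_le_max_aleph0_of_finite'.trans (max_le ?_ hν)
    simpa using hN
  refine le_trans (mk_le_of_injective (f := BoundedFormula.code) fun φ ψ h => ?_) hW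
  exact eq_of_heq (Sigma.mk.inj (BoundedFormula.code_injective φ ψ h)).2

end SortedLanguage

/-! ### Cardinal arithmetic below `κ` -/

namespace SortedStructure

open SortedLanguage

variable {L : SortedLanguage.{u}} {M : SortedStructure L} {κ : Cardinal.{u}}

namespace IsBigModel

theorem aleph0_lt (hM : M.IsBigModel κ) : ℵ₀ < κ := by
  have h : ℵ₀ ≤ κ := by
    rw [← hM.beth_fixed]
    exact aleph0_le_beth _
  rw [← hM.beth_fixed, ← beth_zero, beth_lt_beth, lt_ord]
  simpa using aleph0_pos.trans_le h

theorem isStrongLimit (hM : M.IsBigModel κ) : κ.IsStrongLimit := by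
  rw [← hM.beth_fixed, isStrongLimit_beth]
  exact (isSuccLimit_ord hM.aleph0_lt.le).isSuccPrelimit

theorem two_power_lt (hM : M.IsBigModel κ) {μ : Cardinal.{u}} (h : μ < κ) : 2 ^ μ < κ :=
  hM.isStrongLimit.isStrongPrelimit h

theorem mul_lt (hM : M.IsBigModel κ) {μ ν : Cardinal.{u}} (h : μ < κ) (h' : ν < κ) : μ * ν < κ :=
  mul_lt_of_lt hM.aleph0_lt.le h h'

theorem add_lt (hM : M.IsBigModel κ) {μ ν : Cardinal.{u}} (h : μ < κ) (h' : ν < κ) : μ + ν < κ :=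
  add_lt_of_lt hM.aleph0_lt.le h h'

theorem mk_union_lt (hM : M.IsBigModel κ) {A B : Set M.Elem} (hA : #A < κ) (hB : #B < κ) :
    #(A ∪ B : Set M.Elem) < κ :=
  (mk_union_le A B).trans_lt (hM.add_lt hA hB)

theorem mk_lt_of_finite (hM : M.IsBigModel κ) {A : Set M.Elem} (hA : A.Finite) : #A < κ :=
  (lt_aleph0_iff_set_finite.2 hA).trans hM.aleph0_lt

theorem mk_iUnion_lt (hM : M.IsBigModel κ) {ι : Type u} {A : ι → Set M.Elem} {μ : Cardinal.{u}}
    (hι : #ι < κ) (hμ : μ < κ) (hA : ∀ i, #(A i) ≤ μ) : #(⋃ i, A i) < κ :=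
  ((mk_iUnion_le_sum_mk.trans (sum_le_sum _ _ hA)).trans (by simp)).trans_lt
    (hM.mul_lt hι hμ)

/-- A small infinite bound for the size of the language. -/
theorem exists_mk_formula_le (hM : M.IsBigModel κ) {μ : Cardinal.{u}} (hμ : μ < κ) :
    ∃ ν < κ, ℵ₀ ≤ ν ∧ μ ≤ ν ∧ #L.Sorts ≤ ν ∧ ∀ {α : Type u} (σ : α → L.Sorts), #α ≤ ν →
      #(Formula L σ) ≤ ν := by
  refine ⟨max (max ℵ₀ μ) (max #L.Sorts (max #L.Functions #L.Relations)), ?_, ?_, ?_, ?_, ?_⟩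
  · simp [hM.aleph0_lt, hμ, hM.sorts_small, hM.functions_small, hM.relations_small]
  · simp
  · simp
  · simp
  · exact fun σ h => mk_formula_le (by simp) h (by simp) (by simp) (by simp)

end IsBigModel

/-! ### Algebraic closure -/

/-- The orbit of an element under the automorphisms which fix `B` pointwise. -/
def orbit (B : Set M.Elem) (a : M.Elem) : Set M.Elem := {b | ∃ h : M.Auto, h.Fixes B ∧ h.act a = b}

theorem orbit_finite_of_mem_acl {B : Set M.Elem} {a : M.Elem} (ha : a ∈ M.acl B) :
    (orbit B a).Finite := by
  obtain ⟨φ, hφ, hfin⟩ := ha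
  refine (hfin.image (Sigma.mk a.1)).subset ?_
  rintro _ ⟨h, hB, rfl⟩
  refine ⟨h.toEquiv a.1 a.2, ?_, rfl⟩
  rw [← sat_auto h] at hφ
  refine cast ?_ hφ
  congr 1
  funext k
  rcases k with b | _
  · exact hB.act_eq b.2
  · rfl

/-- If `a` were not algebraic, saturation would realise its type over `B` outside the finite orbit,
whereas homogeneity puts every realisation into the orbit. Together with the previous lemma this
makes algebraicity a matter of automorphisms. -/
theorem mem_acl_of_orbit_finite (hM : M.IsBigModel κ) {B : Set M.Elem} (hB : #B < κ) {a : M.Elem}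
    (ha : (orbit B a).Finite) : a ∈ M.acl B := by
  obtain ⟨s, x₀⟩ := a
  by_contra hacl
  let O : Set (M.carrier s) := Sigma.mk s ⁻¹' orbit B ⟨s, x₀⟩
  have hO : O.Finite := ha.preimage (sigma_mk_injective.injOn)
  let S (φ : Formula L (α := B ⊕ PUnit.{u + 1}) (Sum.elim (fun b => b.1.1) (fun _ => s)))
      (x : M.carrier s) : Prop := M.Sat φ (M.join (fun b => b.1.2) (fun _ => x))
  have hinf : ∀ φ, S φ x₀ → {x | S φ x}.Infinite := fun φ h hf => hacl ⟨φ, h, hf⟩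
  let σ : B ⊕ O → L.Sorts := Sum.elim (fun b => b.1.1) (fun _ => s)
  let v : ∀ i, M.carrier (σ i) := M.join (τ := fun _ : O => s) (fun b : B => b.1.2) (fun o => o.1)
  -- The formulas true at all but finitely many solutions of some formula in the type of `x₀` over
  -- `B`. This set contains that type, as well as `x ≠ o` for each `o` in the orbit.
  let p : Set (Formula L (Sum.elim σ (fun _ : PUnit.{u + 1} => s))) :=
    {ψ | ∃ φ, S φ x₀ ∧ {x | S φ x ∧ ¬ M.Sat ψ (M.join v fun _ => x)}.Finite}
  obtain ⟨y, hy⟩ := hM.saturated (B ⊕ O) PUnit (by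
      rw [mk_sum, lift_id, lift_id]
      exact hM.add_lt hB ((lt_aleph0_iff_set_finite.2 hO).trans hM.aleph0_lt))
    (by simpa using one_lt_aleph0.trans hM.aleph0_lt) σ (fun _ => s) v p (by
      intro q hqp hq
      have : ∃ φ, S φ x₀ ∧ {x | S φ x ∧ ∃ ψ ∈ q, ¬ M.Sat ψ (M.join v fun _ => x)}.Finite := by
        induction q, hq using Set.Finite.induction_on with
        | empty => exact ⟨BoundedFormula.falsum.not, id, by simp⟩
        | @insert ψ q _ _ ih =>
          obtain ⟨φ₁, h₁, f₁⟩ := ih ((Set.subset_insert _ _).trans hqp)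
          obtain ⟨φ₂, h₂, f₂⟩ := hqp (Set.mem_insert _ _)
          refine ⟨φ₁.and φ₂, (sat_and _ _ _).2 ⟨h₁, h₂⟩, (f₁.union f₂).subset ?_⟩
          rintro x ⟨hx, χ, hχ, hn⟩
          have hx' := (sat_and _ _ _).1 hx
          rcases hχ with rfl | hχ
          · exact Or.inr ⟨hx'.2, hn⟩
          · exact Or.inl ⟨hx'.1, χ, hχ, hn⟩
      obtain ⟨φ, h, f⟩ := this
      obtain ⟨x, hx, hx'⟩ := (hinf φ h).exists_notMem_finite f
      refine ⟨fun _ => x, fun ψ hψ => ?_⟩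
      by_contra hn
      exact hx' ⟨hx, ψ, hψ, hn⟩)
  let r : ∀ i : B ⊕ PUnit.{u + 1}, Term L (Sum.elim σ (fun _ : PUnit.{u + 1} => s))
      (Sum.elim (fun b : B => b.1.1) (fun _ => s) i) := fun i => match i with
    | .inl b => Term.var (σ := Sum.elim σ (fun _ : PUnit.{u + 1} => s)) (Sum.inl (Sum.inl b))
    | .inr t => Term.var (σ := Sum.elim σ (fun _ : PUnit.{u + 1} => s)) (Sum.inr t)
  have hr : ∀ φ z, M.Sat (φ.subst r) (M.join v fun _ => z) ↔ S φ z := by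
    intro φ z
    rw [sat_subst]
    refine iff_of_eq (congrArg _ ?_)
    funext i
    rcases i with b | _ <;> rfl
  have h₁ : ∀ φ, S φ x₀ → S φ (y ⟨⟩) := fun φ h =>
    (hr φ _).1 (hy _ ⟨φ, h, by simp [hr]⟩)
  have h₂ : ∀ φ, S φ x₀ ↔ S φ (y ⟨⟩) := fun φ => ⟨h₁ φ, fun h => by
    by_contra hn
    exact h₁ φ.not hn h⟩
  obtain ⟨h, hh⟩ := hM.homogeneous _ (by
    rw [mk_sum, lift_id, lift_id, mk_punit]
    exact hM.add_lt hB (one_lt_aleph0.trans hM.aleph0_lt)) _ _ _ h₂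
  have hyO : y ⟨⟩ ∈ O :=
    ⟨h, fun b hb => Sigma.ext rfl (heq_of_eq (hh (.inl ⟨b, hb⟩))),
      Sigma.ext rfl (heq_of_eq (hh (.inr ⟨⟩)))⟩
  obtain ⟨φ, hφ⟩ := exists_sat_iff_eq (M := M)
    (σ := Sum.elim σ (fun _ : PUnit.{u + 1} => s)) (i := Sum.inl (Sum.inr ⟨y ⟨⟩, hyO⟩))
    (j := Sum.inr ⟨⟩) rfl
  have hφ' : ∀ z, M.Sat φ (M.join v fun _ => z) ↔ z = y ⟨⟩ := fun z => hφ _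
  -- The realisation lies in `O`, so `p` contains the formula saying that it differs from itself.
  exact hy φ.not ⟨BoundedFormula.falsum.not, id, by
    refine (Set.finite_singleton (y ⟨⟩)).subset ?_
    rintro x ⟨-, hx⟩
    exact (hφ' x).1 (by simpa [sat_not] using hx)⟩ ((hφ' _).2 rfl)

theorem acl_mono {A B : Set M.Elem} (h : A ⊆ B) : M.acl A ⊆ M.acl B := by
  rintro a ⟨φ, hφ, hfin⟩
  let r : ∀ i : A ⊕ PUnit.{u + 1},
      Term L (Sum.elim (fun b : B => b.1.1) (fun _ : PUnit.{u + 1} => a.1))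
      (Sum.elim (fun b : A => b.1.1) (fun _ => a.1) i) := fun i => match i with
    | .inl b => Term.var (σ := Sum.elim (fun b : B => b.1.1) (fun _ : PUnit.{u + 1} => a.1))
        (Sum.inl ⟨b, h b.2⟩)
    | .inr t => Term.var (σ := Sum.elim (fun b : B => b.1.1) (fun _ : PUnit.{u + 1} => a.1))
        (Sum.inr t)
  have hr : ∀ z : M.carrier a.1, M.Sat (φ.subst r) (M.join (fun b => b.1.2) fun _ => z) ↔
      M.Sat φ (M.join (fun b => b.1.2) fun _ => z) := by
    intro z
    rw [sat_subst]
    refine iff_of_eq (congrArg _ ?_)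
    funext i
    rcases i with b | _ <;> rfl
  exact ⟨φ.subst r, (hr _).2 hφ, by simpa only [hr] using hfin⟩

theorem exists_finite_of_mem_acl {B : Set M.Elem} {a : M.Elem} (ha : a ∈ M.acl B) :
    ∃ B₀ ⊆ B, B₀.Finite ∧ a ∈ M.acl B₀ := by
  obtain ⟨φ, hφ, hfin⟩ := ha
  obtain ⟨S, hS, h⟩ := BoundedFormula.exists_finite_support (M := M) φ
  let B₀ : Set M.Elem := Subtype.val '' (Sum.inl ⁻¹' S)
  have hB₀ : ∀ b : B, Sum.inl b ∈ S → b.1 ∈ B₀ := fun b hb => ⟨b, hb, rfl⟩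
  let τ : B₀ ⊕ PUnit.{u + 1} → L.Sorts := Sum.elim (fun b : B₀ => b.1.1) (fun _ => a.1)
  obtain ⟨φ', hφ'⟩ := h (τ := τ) (fun i hi => match i, hi with
    | .inl b, hi => Term.var (σ := τ) (Sum.inl ⟨b.1, hB₀ b hi⟩)
    | .inr t, _ => Term.var (σ := τ) (Sum.inr t))
  have hr : ∀ z : M.carrier a.1, M.Sat φ' (M.join (fun b => b.1.2) fun _ => z) ↔
      M.Sat φ (M.join (fun b => b.1.2) fun _ => z) := by
    intro z
    refine hφ' _ _ _ fun i hi => ?_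
    rcases i with b | _ <;> rfl
  exact ⟨B₀, by simp [B₀], (hS.preimage Sum.inl_injective.injOn).image _,
    φ', (hr _).2 hφ, by simpa only [hr] using hfin⟩

theorem subset_acl (B : Set M.Elem) : B ⊆ M.acl B := by
  intro a ha
  obtain ⟨φ, hφ⟩ := exists_sat_iff_eq (M := M)
    (σ := Sum.elim (fun b : B => b.1.1) (fun _ : PUnit.{u + 1} => a.1))
    (i := Sum.inl ⟨a, ha⟩) (j := Sum.inr ⟨⟩) rfl
  have hφ' : ∀ z, M.Sat φ (M.join (fun b => b.1.2) fun _ => z) ↔ z = a.2 := fun z => hφ _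
  exact ⟨φ, (hφ' _).2 rfl, by simp [hφ']⟩

/-- Let `a` be algebraic over a finite `Y ⊆ acl B`. Automorphisms over `B` have finitely many
restrictions to `Y`, and those with a given restriction send `a` into a translate of its finite
orbit over `Y`. -/
theorem acl_acl (hM : M.IsBigModel κ) {B : Set M.Elem} (hB : #B < κ) :
    M.acl (M.acl B) = M.acl B := by
  refine (Set.Subset.antisymm (fun a ha => ?_) (subset_acl _))
  obtain ⟨Y, hY, hYf, ha⟩ := exists_finite_of_mem_acl ha
  have := hYf.to_subtype
  refine mem_acl_of_orbit_finite hM hB ?_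
  let R : Set (Y → M.Elem) := {r | ∃ h : M.Auto, h.Fixes B ∧ r = fun y : Y => h.act y.1}
  have hR : R.Finite := by
    refine (Set.Finite.pi' (t := fun y : Y => orbit B y.1) fun y =>
      orbit_finite_of_mem_acl (hY y.2)).subset ?_
    rintro _ ⟨h, hh, rfl⟩ y
    exact ⟨h, hh, rfl⟩
  have : Nonempty M.Auto := ⟨Auto.refl M⟩
  choose! h hh hr using fun r (hr : r ∈ R) => hr
  refine (hR.biUnion (t := fun r : Y → M.Elem => (h r).act '' orbit Y a) fun r _ =>
    (orbit_finite_of_mem_acl ha).image _).subset ?_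
  rintro _ ⟨g, hg, rfl⟩
  have hgR : (fun y : Y => g.act y) ∈ R := ⟨g, hg, rfl⟩
  refine Set.mem_biUnion hgR ⟨(h _).symm.act (g.act a),
    ⟨(h fun y : Y => g.act y).symm.comp g, fun y hy => ?_, rfl⟩, by simp⟩
  have := congrFun (hr _ hgR) ⟨y, hy⟩
  dsimp only at this
  rw [Auto.act_comp, this]
  simp

theorem acl_subset (hM : M.IsBigModel κ) {A B : Set M.Elem} (hB : #B < κ) (h : A ⊆ M.acl B) :
    M.acl A ⊆ M.acl B :=
  (acl_mono h).trans (acl_acl hM hB).le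

theorem act_mem_acl (hM : M.IsBigModel κ) {B : Set M.Elem} (hB : #B < κ) (g : M.Auto) {a : M.Elem}
    (ha : a ∈ M.acl B) : g.act a ∈ M.acl (g.act '' B) := by
  refine mem_acl_of_orbit_finite hM (by rwa [g.mk_image]) ?_
  refine ((orbit_finite_of_mem_acl ha).image g.act).subset ?_
  rintro _ ⟨h, hh, rfl⟩
  refine ⟨g.symm.act (h.act (g.act a)), ⟨g.symm.comp (h.comp g), fun b hb => ?_, rfl⟩, by simp⟩
  simp [hh _ (Set.mem_image_of_mem _ hb)]

theorem image_acl (hM : M.IsBigModel κ) {B : Set M.Elem} (hB : #B < κ) (g : M.Auto) :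
    g.act '' M.acl B = M.acl (g.act '' B) := by
  refine Set.Subset.antisymm (Set.image_subset_iff.2 fun a ha => act_mem_acl hM hB g ha) ?_
  intro a ha
  have := act_mem_acl hM (by rwa [g.mk_image]) g.symm ha
  rw [g.image_symm_image] at this
  exact ⟨_, this, by simp⟩

theorem Auto.Fixes.image_acl (hM : M.IsBigModel κ) {B : Set M.Elem} (hB : #B < κ) {g : M.Auto}
    (hg : g.Fixes B) : g.act '' M.acl B = M.acl B := by
  rw [SortedStructure.image_acl hM hB, hg.image_eq]

/-- The closure is covered by finite solution sets, one for each formula with parameters in `B`. -/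
theorem mk_acl_lt (hM : M.IsBigModel κ) {B : Set M.Elem} (hB : #B < κ) : #(M.acl B) < κ := by
  obtain ⟨ν, hνκ, hν, hBν, hSν, hform⟩ := hM.exists_mk_formula_le hB
  let σ (s : L.Sorts) : B ⊕ PUnit.{u + 1} → L.Sorts := Sum.elim (fun b : B => b.1.1) (fun _ => s)
  let T (s : L.Sorts) (φ : Formula L (σ s)) : Set (M.carrier s) :=
    {x | M.Sat φ (M.join (fun b => b.1.2) fun _ => x)}
  have hα : #(B ⊕ PUnit.{u + 1}) ≤ ν := by
    rw [mk_sum, lift_id, lift_id, mk_punit]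
    exact add_le_of_le hν hBν (one_le_aleph0.trans hν)
  let I := {i : Σ s, Formula L (σ s) // (T i.1 i.2).Finite}
  have hI : #I ≤ ν := (mk_subtype_le _).trans (by
    rw [mk_sigma]
    refine (sum_le_sum _ (fun _ => ν) fun s => hform _ hα).trans ?_
    rw [sum_const']
    exact mul_le_of_le hν hSν le_rfl)
  have hsub : M.acl B ⊆ ⋃ i : I, Sigma.mk i.1.1 '' T i.1.1 i.1.2 := by
    rintro ⟨s, x⟩ ⟨φ, hφ, hf⟩
    exact Set.mem_iUnion.2 ⟨⟨⟨s, φ⟩, hf⟩, x, hφ, rfl⟩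
  exact (mk_le_mk_of_subset hsub).trans_lt (hM.mk_iUnion_lt (μ := ℵ₀) (hI.trans_lt hνκ)
    hM.aleph0_lt fun i => (lt_aleph0_iff_set_finite.2 (i.2.image _)).le)

end SortedStructure

/-! ### Partition calculus -/

/-- A cardinal that absorbs the sum of its powers with exponents `#(β s)` bounds the W-type, and `(2
^ χ) ^ χ = 2 ^ χ`. -/
theorem Cardinal.mk_wType_le_two_power {S : Type u} {β : S → Type u} {χ : Cardinal.{u}}
    (hχ : ℵ₀ ≤ χ) (hS : #S ≤ 2 ^ χ) (hβ : ∀ s, #(β s) ≤ χ) : #(WType β) ≤ 2 ^ χ := by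
  refine WType.cardinalMk_le_of_le ?_
  have h2 : (2 ^ χ : Cardinal.{u}) ≠ 0 := power_ne_zero _ two_ne_zero
  refine (sum_le_sum _ (fun _ => 2 ^ χ) fun s => ?_).trans ?_
  · refine (power_le_power_left h2 (hβ s)).trans ?_
    rw [← power_mul, mul_eq_self hχ]
  · rw [sum_const']
    exact mul_le_of_le (hχ.trans (cantor χ).le) hS le_rfl

section Partition

open Classical

variable {I X : Type u} [LinearOrder I] [WellFoundedLT I]

/-- A large set has a large subset in which the colour of a finite set does not depend on its
greatest element. -/
theorem exists_end_homogeneous {ι : Type u} [LinearOrder ι] [WellFoundedLT ι] (hι : ℵ₀ ≤ #ι)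
    (hX : #X ≤ 2 ^ #ι) (S : Set I) (hS : 2 ^ #ι < #S) (c : Finset I → X) :
    ∃ x, ∃ T ⊆ S, #T = #ι ∧ ∀ F : Finset I, ↑F ⊆ T → ∀ y ∈ T, (∀ z ∈ F, z < y) →
      c (insert y F) = c (insert x F) := by
  let N {i : ι} (z : Set.Iio i → I) (p : Finset (Set.Iio i) → X) : Set I :=
    {y ∈ S | (∀ j, z j < y) ∧ ∀ F : Finset (Set.Iio i), c (insert y (F.image z)) = p F}
  have hne : S.Nonempty := by
    rw [Set.nonempty_iff_ne_empty]
    rintro rfl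
    simp at hS
  obtain ⟨s₀, hs₀⟩ := hne
  -- A code consists of the codes of its predecessors and a prescribed colouring over them; `ev`
  -- decodes it to the least element of `S` above the predecessors with those colours, or to `s₀` if
  -- there is none.
  let W := WType (α := Σ i : ι, Finset (Set.Iio i) → X) (fun s => Set.Iio s.1)
  let ev : W → I := WType.elim I fun s =>
    if h : (N s.2 s.1.2).Nonempty then wellFounded_lt.min _ h else s₀
  have hW : #W ≤ 2 ^ #ι := by
    refine mk_wType_le_two_power hι ?_ fun s => mk_set_le _
    rw [mk_sigma]
    refine (sum_le_sum _ (fun _ => 2 ^ #ι) fun i => ?_).trans ?_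
    · rw [mk_arrow, lift_id, lift_id]
      have hF : #(Finset (Set.Iio i)) ≤ #ι := by
        rcases finite_or_infinite (Set.Iio i) with h | h
        · exact (lt_aleph0_of_finite _).le.trans hι
        · rw [mk_finset_of_infinite]
          exact mk_set_le _
      calc #X ^ #(Finset (Set.Iio i)) ≤ (2 ^ #ι) ^ #(Finset (Set.Iio i)) :=
            power_le_power_right hX
        _ ≤ (2 ^ #ι) ^ #ι := power_le_power_left (power_ne_zero _ two_ne_zero) hF
        _ = 2 ^ #ι := by rw [← power_mul, mul_eq_self hι]
    · rw [sum_const']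
      exact mul_le_of_le (hι.trans (cantor _).le) (cantor _).le le_rfl
  -- There are at most `2 ^ #ι` codes, so some `x` in `S` is not decoded. The branch `w` below
  -- always prescribes the colours that `x` has.
  obtain ⟨x, hxS, hx⟩ : ∃ x ∈ S, x ∉ Set.range ev := by
    by_contra! h
    exact (hS.trans_le ((mk_le_mk_of_subset (show S ⊆ Set.range ev from h)).trans
      (mk_range_le.trans hW))).false
  let w : ι → W := wellFounded_lt.fix fun i ih =>
    ⟨⟨i, fun F => c (insert x (F.image fun j : Set.Iio i => ev (ih j.1 j.2)))⟩,
      fun j => ih j.1 j.2⟩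
  let a : ι → I := fun i => ev (w i)
  have hw : ∀ i, w i = ⟨⟨i, fun F => c (insert x (F.image fun j : Set.Iio i => a j))⟩,
      fun j => w j⟩ := fun i => wellFounded_lt.fix_eq _ i
  have key : ∀ i, (∀ j < i, a j < x) →
      a i ∈ N (fun j : Set.Iio i => a j) (fun F => c (insert x (F.image fun j : Set.Iio i => a j))) ∧
        a i < x := by
    intro i hi
    have hxN : x ∈ N (fun j : Set.Iio i => a j) (fun F => c (insert x (F.image fun j : Set.Iio i => a j))) :=
      ⟨hxS, fun j => hi j j.2, fun F => rfl⟩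
    have hai : a i = wellFounded_lt.min _ ⟨x, hxN⟩ := by
      change ev (w i) = _
      rw [hw]
      exact dif_pos (⟨x, hxN⟩ : Set.Nonempty _)
    -- Minimality gives `a i ≤ x`, as `x` itself is a candidate; equality is excluded since `x` is
    -- outside the range of `ev`.
    refine ⟨hai ▸ WellFounded.min_mem _ _ _, lt_of_le_of_ne ?_ fun h => hx ⟨w i, h⟩⟩
    rw [hai]
    exact not_lt.1 (WellFounded.not_lt_min _ _ hxN)
  have hlt : ∀ i, a i < x := fun i => WellFoundedLT.induction i fun i ih => (key i ih).2
  have hN := fun i => (key i fun j _ => hlt j).1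
  have hmono : StrictMono a := fun j i hji => (hN i).2.1 ⟨j, hji⟩
  refine ⟨x, Set.range a, Set.range_subset_iff.2 fun i => (hN i).1,
    mk_range_eq a hmono.injective, ?_⟩
  rintro F hF _ ⟨i, rfl⟩ hi
  have hinj : Function.Injective fun j : Set.Iio i => a j :=
    hmono.injective.comp Subtype.val_injective
  have hF' : (F.preimage (fun j : Set.Iio i => a j) hinj.injOn).image
      (fun j : Set.Iio i => a j) = F := by
    rw [Finset.image_preimage]
    refine Finset.filter_true_of_mem fun z hz => ?_
    obtain ⟨j, rfl⟩ := hF hz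
    exact ⟨⟨j, hmono.lt_iff_lt.1 (hi _ hz)⟩, rfl⟩
  have := (hN i).2.2 (F.preimage (fun j : Set.Iio i => a j) hinj.injOn)
  beta_reduce at this
  rwa [hF'] at this

/-- A form of the Erdős–Rado theorem. -/
theorem erdos_rado (n : ℕ) (α : Ordinal.{u}) (hX : #X ≤ beth α) (S : Set I)
    (hS : beth (α + (2 * n : ℕ)) ≤ #S) (c : Finset I → X) :
    ∃ x, ∃ T ⊆ S, beth α ≤ #T ∧ ∀ F : Finset I, ↑F ⊆ T → F.card = n → c F = x := by
  induction n generalizing S c with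
  | zero =>
    refine ⟨c ∅, S, subset_rfl, by simpa using hS, fun F _ hF => ?_⟩
    rw [Finset.card_eq_zero.1 hF]
  | succ n ih =>
    let δ := beth (α + (2 * n : ℕ))
    let ι := δ.ord.ToType
    have hι : #ι = δ := mk_ord_toType δ
    -- Each increase of `n` costs two steps of the beth hierarchy: one for `2 ^ δ`, one for the
    -- strict inequality.
    have hS' : 2 ^ δ < #S := by
      refine lt_of_lt_of_le ?_ hS
      rw [← beth_add_one, beth_lt_beth, add_assoc]
      norm_cast
      simp only [add_lt_add_iff_left, Nat.cast_lt]
      omega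
    have hαδ : beth α ≤ δ := beth_le_beth.2 (by simp)
    obtain ⟨x, T₀, hT₀S, hT₀, h⟩ := exists_end_homogeneous (ι := ι)
      (by rw [hι]; exact aleph0_le_beth _)
      (by rw [hι]; exact hX.trans (hαδ.trans (cantor δ).le)) S (by rwa [hι]) c
    -- On `T₀` the greatest element does not influence the colour and may be replaced by `x`, which
    -- reduces sets of size `n + 1` to sets of size `n`.
    obtain ⟨y, T, hT, hTα, h'⟩ := ih T₀ (by rw [hT₀, hι]) (fun F => c (insert x F))
    refine ⟨y, T, hT.trans hT₀S, hTα, fun F hF hn => ?_⟩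
    have hne : F.Nonempty := Finset.card_pos.1 (by omega)
    have hm := F.max'_mem hne
    rw [← Finset.insert_erase hm, h _ _ _ (hT (hF hm))]
    · exact h' _ (subset_trans (by simp) hF) (by rw [Finset.card_erase_of_mem hm, hn]; rfl)
    · intro z hz
      exact Finset.lt_max'_of_mem_erase_max' _ hne hz
    · exact subset_trans (subset_trans (by simp) hF) hT

/-- For every colouring of the finite subsets of a large well-ordered set there is a choice of one
colour for each size, such that there are arbitrarily large finite sets all of whose subsets have
the chosen colours. -/
theorem exists_coherent_colours {ν : Cardinal.{u}} (hν : ℵ₀ ≤ ν) (hX : #X ≤ ν)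
    (hI : beth (ν.ord + (Order.succ ν).ord) ≤ #I) (c : Finset I → X) :
    ∃ t : ℕ → X, ∀ n, ∃ F : Finset I, F.card = n ∧ ∀ G ⊆ F, c G = t G.card := by
  let θ := (Order.succ ν).ord
  have hreg : (Order.succ ν).IsRegular := isRegular_succ hν
  have hlim : Order.IsSuccLimit θ := isSuccLimit_ord (hν.trans (Order.le_succ ν))
  -- Homogeneity in sizes below `n` is required on sets at every level below `θ`, because passing to
  -- the next size loses finitely many levels.
  let H (n : ℕ) (t : ℕ → X) : Prop := ∀ α < θ, ∃ S : Set I, beth (ν.ord + α) ≤ #S ∧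
    ∀ F : Finset I, ↑F ⊆ S → F.card < n → c F = t F.card
  have step : ∀ n t, H n t → ∃ x, H (n + 1) (Function.update t n x) := by
    intro n t ht
    by_contra! hn
    simp only [H] at hn
    push Not at hn
    choose f hfθ hf using hn
    -- If every colour `x` fails at a level `f x`, all failures occur below one level under `θ`, by
    -- regularity. Erdős–Rado from `2 * n` levels higher then produces a colour that does not fail.
    have hsup : (⨆ x, f x) < θ := by
      refine Ordinal.iSup_lt_of_lt_cof ?_ hfθ
      rw [hreg.cof_ord]
      exact Order.lt_succ_of_le hX
    have hsup' : (⨆ x, f x) + (2 * n : ℕ) < θ :=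
      (Ordinal.isPrincipal_add_ord (hν.trans (Order.le_succ ν))) hsup
        ((Ordinal.natCast_lt_omega0 _).trans_le (by
          rw [← ord_aleph0]; exact ord_le_ord.2 (hν.trans (Order.le_succ ν))))
    obtain ⟨S, hS, h⟩ := ht _ hsup'
    obtain ⟨x, T, hTS, hT, h'⟩ := erdos_rado n (ν.ord + ⨆ x, f x)
      (hX.trans ((le_beth_ord ν).trans (beth_le_beth.2 (by simp)))) S (by rwa [add_assoc]) c
    obtain ⟨F, hF, hFn, hne⟩ := hf x T ((beth_le_beth.2 (by
      gcongr; exact Ordinal.le_iSup f x)).trans hT)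
    refine hne ?_
    rcases Nat.lt_succ_iff_lt_or_eq.1 hFn with hlt | heq
    · rw [Function.update_of_ne hlt.ne]
      exact h F (hF.trans hTS) hlt
    · rw [heq, Function.update_self]
      exact h' F hF heq
  have h0 : H 0 fun _ => c ∅ := fun α hα => ⟨Set.univ, by
    rw [mk_univ]
    exact (beth_le_beth.2 (by gcongr)).trans hI, fun F _ h => absurd h (by simp)⟩
  choose x hx using step
  let s : ∀ n, {t // H n t} := fun n =>
    Nat.rec (motive := fun n => {t // H n t}) ⟨fun _ => c ∅, h0⟩ (fun n t => ⟨_, hx n t.1 t.2⟩) n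
  have hs : ∀ n, (s (n + 1)).1 = Function.update (s n).1 n (x n (s n).1 (s n).2) := fun n => rfl
  have hagree : ∀ n k, k < n → (s n).1 k = (s (k + 1)).1 k := by
    intro n
    induction n with
    | zero => intro k hk; simp at hk
    | succ n ih =>
      intro k hk
      rcases Nat.lt_succ_iff_lt_or_eq.1 hk with hlt | rfl
      · rw [hs, Function.update_of_ne hlt.ne, ih k hlt]
      · rfl
  refine ⟨fun k => (s (k + 1)).1 k, fun n => ?_⟩
  obtain ⟨S, hS, h⟩ := (s (n + 1)).2 0 hlim.bot_lt
  have hSinf : S.Infinite := by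
    rw [← Set.infinite_coe_iff, infinite_iff]
    exact (aleph0_le_beth _).trans hS
  obtain ⟨F, hF, hFn⟩ := hSinf.exists_subset_card_eq n
  refine ⟨F, hFn, fun G hG => ?_⟩
  have hGn : G.card < n + 1 := by
    have := Finset.card_le_card hG
    omega
  rw [h G (subset_trans (by exact_mod_cast hG) hF) hGn, hagree _ _ hGn]

end Partition

theorem Set.Finite.exists_finset_subset_biUnion {E : Type*} {ι : Type*} {Y : ι → Set E} {A : Set E}
    (hA : A.Finite) (h : A ⊆ ⋃ i, Y i) : ∃ F : Finset ι, A ⊆ ⋃ i ∈ F, Y i := by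
  classical
  induction A, hA using Set.Finite.induction_on with
  | empty => exact ⟨∅, by simp⟩
  | @insert a A _ _ ih =>
    obtain ⟨F, hF⟩ := ih ((Set.subset_insert _ _).trans h)
    obtain ⟨i, hi⟩ := Set.mem_iUnion.1 (h (Set.mem_insert _ _))
    refine ⟨insert i F, Set.insert_subset ?_ (hF.trans ?_)⟩
    · exact Set.mem_biUnion (Finset.mem_insert_self _ _) hi
    · exact Set.biUnion_subset_biUnion_left fun j hj => Finset.mem_insert_of_mem hj

namespace SortedStructure

open SortedLanguage

variable {L : SortedLanguage.{u}} {M : SortedStructure L} {κ : Cardinal.{u}}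

/-! ### Types of families of copies of a set -/

section Copies

variable (P A : Set M.Elem) {K K' : Type u}

/-- The sorts of a tuple which enumerates `P` and a family, indexed by `K`, of copies of `A`. -/
abbrev copySort (K : Type u) : P ⊕ (K × A) → L.Sorts := Sum.elim (fun b => b.1.1) (fun a => a.2.1.1)

/-- The tuple which enumerates `P` and the images of `A` under the automorphisms `g k`. -/
abbrev copyVal (g : K → M.Auto) : ∀ i, M.carrier (copySort P A K i) :=
  M.join (fun b : P => b.1.2) (fun a : K × A => (g a.1).toEquiv _ a.2.1.2)

/-- The complete type over `P` of the images of `A` under the automorphisms `g k`. -/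
def copyType (g : K → M.Auto) : Set (Formula L (copySort P A K)) := {φ | M.Sat φ (copyVal P A g)}

/-- Relabelling of the copies. -/
def copyRelabel (f : K → K') (φ : Formula L (copySort P A K)) : Formula L (copySort P A K') :=
  φ.subst fun i => match i with
    | .inl b => Term.var (σ := copySort P A K') (Sum.inl b)
    | .inr a => Term.var (σ := copySort P A K') (Sum.inr (f a.1, a.2))

variable {P A}

theorem sat_copyRelabel (f : K → K') (φ : Formula L (copySort P A K))
    (w : ∀ a : K' × A, M.carrier a.2.1.1) :
    M.Sat (copyRelabel P A f φ) (M.join (fun b => b.1.2) w) ↔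
      M.Sat φ (M.join (fun b => b.1.2) fun a : K × A => w (f a.1, a.2)) := by
  unfold copyRelabel
  rw [sat_subst]
  refine iff_of_eq (congrArg _ ?_)
  funext i
  rcases i with b | a <;> rfl

theorem mk_copyIndex_lt (hM : M.IsBigModel κ) (hP : #P < κ) (hA : #A < κ) (hK : #K < κ) :
    #(P ⊕ (K × A)) < κ := by
  rw [mk_sum, mk_prod, lift_id, lift_id, lift_id, lift_id]
  exact hM.add_lt hP (hM.mul_lt hK hA)

theorem exists_auto_of_copyType_eq (hM : M.IsBigModel κ) (hP : #P < κ) (hA : #A < κ)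
    (hK : #K < κ) {g g' : K → M.Auto} (h : copyType P A g = copyType P A g') :
    ∃ h : M.Auto, h.Fixes P ∧ ∀ k, ∀ a ∈ A, h.act ((g k).act a) = (g' k).act a := by
  obtain ⟨h, hh⟩ := hM.homogeneous _ (mk_copyIndex_lt hM hP hA hK) _ (copyVal P A g)
    (copyVal P A g') (fun φ => Set.ext_iff.1 h φ)
  exact ⟨h, fun b hb => Sigma.ext rfl (heq_of_eq (hh (.inl ⟨b, hb⟩))),
    fun k a ha => Sigma.ext rfl (heq_of_eq (hh (.inr (k, ⟨a, ha⟩))))⟩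

end Copies

namespace Auto

theorem image_eq_of_act_eq {A : Set M.Elem} {g g' : M.Auto} (h : ∀ a ∈ A, g.act a = g'.act a) :
    g.act '' A = g'.act '' A :=
  Set.image_congr h

end Auto

/-! ### Consequences of the axioms -/

namespace IsIndependenceRelation

variable {ind : Set M.Elem → Set M.Elem → Set M.Elem → Prop} {A A' B B' C C' : Set M.Elem}

theorem of_image (hind : M.IsIndependenceRelation κ ind) (hA : #A < κ) (hB : #B < κ) (hC : #C < κ)
    (g : M.Auto) (h : ind (g.act '' A) (g.act '' C) (g.act '' B)) : ind A C B := by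
  have := hind.invariance _ _ _ (by rwa [g.mk_image]) (by rwa [g.mk_image]) (by rwa [g.mk_image])
    g.symm h
  simpa only [Auto.image_symm_image] using this

/-- Local character over `C` gives a base inside `C`, which base monotonicity raises to `C`. -/
theorem existence (hind : M.IsIndependenceRelation κ ind) (hA : #A < κ) (hC : #C < κ) :
    ind A C C := by
  obtain ⟨μ, -, h⟩ := hind.local_character A hA
  obtain ⟨D, hD, -, hAD⟩ := h C hC
  exact hind.base_monotonicity A C C D hA hC hD subset_rfl hAD

theorem exists_auto (hM : M.IsBigModel κ) (hind : M.IsIndependenceRelation κ ind) (hA : #A < κ)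
    (hC : #C < κ) (hB : #B < κ) : ∃ g : M.Auto, g.Fixes C ∧ ind (g.act '' A) C B := by
  obtain ⟨g, hg, h⟩ := hind.extension A C C (C ∪ B) hA hC hC (hM.mk_union_lt hC hB)
    (hind.existence hA hC) Set.subset_union_left
  exact ⟨g, hg.mono Set.subset_union_left, hind.monotonicity _ _ _ _ _ (by rwa [g.mk_image])
    (hM.mk_union_lt hC hB) hC h subset_rfl Set.subset_union_right⟩

/-- Some conjugate of `A` over `C` is independent from `B`, and `A` is its only conjugate as a set.
This applies to the empty set and to algebraic closures. -/
theorem ind_of_forall_image_eq (hM : M.IsBigModel κ) (hind : M.IsIndependenceRelation κ ind)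
    (hA : #A < κ) (hC : #C < κ) (hB : #B < κ)
    (h : ∀ g : M.Auto, g.Fixes C → g.act '' A = A) : ind A C B := by
  obtain ⟨g, hg, h'⟩ := exists_auto hM hind hA hC hB
  rwa [h g hg] at h'

theorem extend_right (hind : M.IsIndependenceRelation κ ind)
    (hA : #A < κ) (hC : #C < κ) (hB : #B < κ) (hB' : #B' < κ) (hBB' : B ⊆ B')
    (h : ind A C B) (hg : ∀ g : M.Auto, g.Fixes (B ∪ C) → g.act '' B' = B') : ind A C B' := by
  obtain ⟨g, hgf, h'⟩ := hind.extension A B C B' hA hB hC hB' h hBB'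
  refine hind.of_image hA hB' hC g ?_
  rwa [hg g hgf, (hgf.mono Set.subset_union_right).image_eq]

theorem union_base_right (hM : M.IsBigModel κ) (hind : M.IsIndependenceRelation κ ind)
    (hA : #A < κ) (hC : #C < κ) (hB : #B < κ) (h : ind A C B) : ind A C (B ∪ C) :=
  hind.extend_right hA hC hB (hM.mk_union_lt hB hC) Set.subset_union_left h
    fun _ hg => hg.image_eq

/-- Normality absorbs the bases into the left sides, after which transitivity applies along `C ⊆ C ∪
A ⊆ A' ∪ (C ∪ A)`. -/
theorem union_left (hM : M.IsBigModel κ) (hind : M.IsIndependenceRelation κ ind)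
    (hA : #A < κ) (hA' : #A' < κ) (hC : #C < κ) (hB : #B < κ) (h : ind A C B)
    (h' : ind A' (C ∪ A) B) : ind (A ∪ A') C B := by
  have hCA := hM.mk_union_lt hC hA
  have h₁ := hind.normality _ _ _ hA hB hC h
  have h₂ := hind.normality _ _ _ hA' hB hCA h'
  rw [Set.union_comm A C] at h₁
  have hs := hM.mk_union_lt hA' hCA
  have h₃ := hind.transitivity B (A' ∪ (C ∪ A)) (C ∪ A) C hB hs Set.subset_union_left
    Set.subset_union_right h₂ h₁
  refine hind.monotonicity _ _ _ _ _ hs hB hC h₃ ?_ subset_rfl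
  exact Set.union_subset (fun x hx => Or.inr (Or.inr hx)) Set.subset_union_left

theorem acl_left (hM : M.IsBigModel κ) (hind : M.IsIndependenceRelation κ ind)
    (hA : #A < κ) (hC : #C < κ) (hB : #B < κ) (h : ind A C B) : ind (M.acl (A ∪ C)) C B := by
  have hAC := hM.mk_union_lt hA hC
  have hacl := mk_acl_lt hM hAC
  have h' : ind (M.acl (A ∪ C)) (C ∪ A) B := by
    rw [Set.union_comm C A]
    exact ind_of_forall_image_eq hM hind hacl hAC hB fun g hg => hg.image_acl hM hAC
  refine hind.monotonicity _ _ _ _ _ (hM.mk_union_lt hA hacl) hB hC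
    (union_left hM hind hA hacl hC hB h h') Set.subset_union_right subset_rfl

end IsIndependenceRelation

open IsIndependenceRelation in
theorem IsStrictIndependenceRelation.mIndep (hM : M.IsBigModel κ)
    {ind : Set M.Elem → Set M.Elem → Set M.Elem → Prop} (hind : M.IsStrictIndependenceRelation κ ind)
    {A B C : Set M.Elem} (hA : #A < κ) (hC : #C < κ) (hB : #B < κ) (h : ind A C B) :
    M.MIndep A C B := by
  have hI := hind.toIsIndependenceRelation
  intro C' hCC' hC'
  have hBC := hM.mk_union_lt hB hC
  have hacl := mk_acl_lt hM hBC
  have hC's : #C' < κ := (mk_le_mk_of_subset hC').trans_lt hacl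
  have h₁ : ind A C (M.acl (B ∪ C)) :=
    hI.extend_right hA hC hBC hacl (subset_acl _) (union_base_right hM hI hA hC hB h)
      fun g hg => (hg.mono Set.subset_union_left).image_acl hM hBC
  have h₂ : ind A C' (M.acl (B ∪ C)) :=
    hI.base_monotonicity _ _ _ _ hA hacl hCC' hC' h₁
  have h₃ := acl_left hM hI hA hC's hacl h₂
  refine Set.Subset.antisymm (fun a ⟨ha, ha'⟩ => ?_) (Set.subset_inter
    (acl_mono Set.subset_union_right) (acl_mono Set.subset_union_right))
  refine hind.anti_reflexivity a C' hC's (hI.monotonicity _ _ _ _ _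
    (mk_acl_lt hM (hM.mk_union_lt hA hC's)) hacl hC's h₃ (by simpa using ha) ?_)
  have hsub : B ∪ C' ⊆ M.acl (B ∪ C) :=
    Set.union_subset (Set.subset_union_left.trans (subset_acl _)) hC'
  simpa using acl_subset hM hBC hsub ha'

theorem IsStrictIndependenceRelation.thornIndep (hM : M.IsBigModel κ)
    {ind : Set M.Elem → Set M.Elem → Set M.Elem → Prop} (hind : M.IsStrictIndependenceRelation κ ind)
    {A B C : Set M.Elem} (hA : #A < κ) (hC : #C < κ) (hB : #B < κ) (h : ind A C B) :
    M.ThornIndep κ A C B := by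
  intro B' hB' hBB'
  obtain ⟨g, hg, h'⟩ := hind.extension A B C B' hA hB hC hB' h hBB'
  exact ⟨g, hg, hind.mIndep hM (by rwa [g.mk_image]) hC hB' h'⟩

/-! ### Uniform local character -/

/-- Over every small set `A` is independent over a subset of size at most `μ`. -/
def LocalBound (κ : Cardinal.{u}) (ind : Set M.Elem → Set M.Elem → Set M.Elem → Prop)
    (A : Set M.Elem) (μ : Cardinal.{u}) : Prop :=
  ∀ B : Set M.Elem, #B < κ → ∃ C ⊆ B, #C ≤ μ ∧ ind A C B

namespace IsIndependenceRelation

variable {ind : Set M.Elem → Set M.Elem → Set M.Elem → Prop} {A A' : Set M.Elem}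
  {μ : Cardinal.{u}}

theorem exists_localBound (hind : M.IsIndependenceRelation κ ind) (hA : #A < κ) :
    ∃ μ < κ, LocalBound κ ind A μ := by
  obtain ⟨μ, hμ, h⟩ := hind.local_character A hA
  refine ⟨μ, hμ, fun B hB => ?_⟩
  obtain ⟨C, hC, hCμ, h⟩ := h B hB
  exact ⟨C, hC, hCμ.le, h⟩

theorem localBound_image (hind : M.IsIndependenceRelation κ ind) (hA : #A < κ)
    (h : LocalBound κ ind A μ) (g : M.Auto) : LocalBound κ ind (g.act '' A) μ := by
  intro B hB
  have hB' : #(g.symm.act '' B) < κ := by rwa [g.symm.mk_image]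
  obtain ⟨C, hC, hCμ, h'⟩ := h (g.symm.act '' B) hB'
  have := hind.invariance _ _ _ hA hB' ((mk_le_mk_of_subset hC).trans_lt hB') g h'
  rw [Auto.image_image_symm] at this
  refine ⟨g.act '' C, ?_, by rwa [g.mk_image], this⟩
  simpa [Auto.image_image_symm] using Set.image_mono (f := g.act) hC

/-- A base for `A'` is taken inside `B ∪ A` and only its part in `B` is kept: the rest lies in `A`,
which `union_left` allows in the base. -/
theorem localBound_union (hM : M.IsBigModel κ) (hind : M.IsIndependenceRelation κ ind)
    (hA : #A < κ) (hA' : #A' < κ) (hμ : ℵ₀ ≤ μ) (h : LocalBound κ ind A μ)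
    (h' : LocalBound κ ind A' μ) : LocalBound κ ind (A ∪ A') μ := by
  intro B hB
  obtain ⟨C₁, hC₁, hC₁μ, h₁⟩ := h B hB
  have hBA := hM.mk_union_lt hB hA
  obtain ⟨C₂, hC₂, hC₂μ, h₂⟩ := h' (B ∪ A) hBA
  have hs : C₁ ∪ C₂ ∩ B ⊆ B := Set.union_subset hC₁ Set.inter_subset_right
  have hsB : #(C₁ ∪ C₂ ∩ B : Set M.Elem) < κ := (mk_le_mk_of_subset hs).trans_lt hB
  refine ⟨C₁ ∪ C₂ ∩ B, hs, (mk_union_le _ _).trans (add_le_of_le hμ hC₁μ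
    ((mk_le_mk_of_subset Set.inter_subset_left).trans hC₂μ)), ?_⟩
  refine union_left hM hind hA hA' hsB hB
    (hind.base_monotonicity _ _ _ _ hA hB Set.subset_union_left hs h₁) ?_
  refine hind.monotonicity _ _ _ _ _ hA' hBA (hM.mk_union_lt hsB hA)
    (hind.base_monotonicity A' (B ∪ A) (C₁ ∪ C₂ ∩ B ∪ A) C₂ hA' hBA ?_
      (Set.union_subset_union_left _ hs) h₂) subset_rfl Set.subset_union_left
  intro x hx
  rcases hC₂ hx with hB | hA
  · exact Or.inl (Or.inr ⟨hx, hB⟩)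
  · exact Or.inr hA

/-- There are at most `μ` finite subfamilies; the union of bases for all of them still has size at
most `μ`, and finite character finishes. That the bound does not grow is essential in the converse
direction of the theorem. -/
theorem localBound_iUnion (hM : M.IsBigModel κ) (hind : M.IsIndependenceRelation κ ind)
    {ι : Type u} {A : ι → Set M.Elem} {ν : Cardinal.{u}} (hν : ν < κ) (hA : ∀ i, #(A i) ≤ ν)
    (hμ : ℵ₀ ≤ μ) (hμκ : μ < κ) (hι : #ι ≤ μ) (hne : Nonempty ι)
    (h : ∀ i, LocalBound κ ind (A i) μ) : LocalBound κ ind (⋃ i, A i) μ := by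
  classical
  have hsmall : ∀ F : Finset ι, #(⋃ i ∈ F, A i : Set M.Elem) < κ := fun F =>
    (mk_le_mk_of_subset (Set.iUnion₂_subset fun i _ => Set.subset_iUnion A i)).trans_lt
      (hM.mk_iUnion_lt (hι.trans_lt hμκ) hν hA)
  have hfin : ∀ F : Finset ι, F.Nonempty → LocalBound κ ind (⋃ i ∈ F, A i) μ := by
    intro F hF
    induction hF using Finset.Nonempty.cons_induction with
    | singleton i => simpa using h i
    | cons i F hi hF ih =>
      have := localBound_union hM hind ((hA i).trans_lt hν) (hsmall F) hμ (h i) ih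
      simpa using this
  intro B hB
  have hfin' : ∀ F : Finset ι, ∃ C ⊆ B, #C ≤ μ ∧ (F.Nonempty → ind (⋃ i ∈ F, A i) C B) := by
    intro F
    by_cases hF : F.Nonempty
    · obtain ⟨C, hC, hCμ, hi⟩ := hfin F hF B hB
      exact ⟨C, hC, hCμ, fun _ => hi⟩
    · exact ⟨∅, by simp, by simp, fun h => absurd h hF⟩
  choose C hCB hCμ hC using hfin'
  have hsub : ⋃ F, C F ⊆ B := Set.iUnion_subset hCB
  have hUB := (mk_le_mk_of_subset hsub).trans_lt hB
  have hFι : #(Finset ι) ≤ μ := by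
    rcases finite_or_infinite ι with hf | hf
    · exact (lt_aleph0_of_finite _).le.trans hμ
    · rwa [mk_finset_of_infinite]
  refine ⟨⋃ F, C F, hsub, ?_, hind.finite_character _ _ _
    (hM.mk_iUnion_lt (hι.trans_lt hμκ) hν hA) hB hUB fun A₀ hA₀ hfin₀ => ?_⟩
  · refine (mk_iUnion_le_sum_mk.trans (sum_le_sum _ _ hCμ)).trans ?_
    rw [sum_const']
    exact mul_le_of_le hμ hFι le_rfl
  · obtain ⟨F, hF⟩ := hfin₀.exists_finset_subset_biUnion hA₀
    obtain ⟨i₀⟩ := hne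
    have := hind.base_monotonicity _ _ _ _ (hsmall (insert i₀ F)) hB
      (Set.subset_iUnion C (insert i₀ F)) hsub (hC _ (Finset.insert_nonempty _ _))
    refine hind.monotonicity _ _ _ _ _ (hsmall _) hB hUB this (hF.trans ?_) subset_rfl
    exact Set.biUnion_subset_biUnion_left fun j hj => Finset.mem_insert_of_mem hj

end IsIndependenceRelation

end SortedStructure

/-! ### Small subsets of unions of regular length -/

theorem Cardinal.IsRegular.exists_forall_lt {ρ : Cardinal.{u}} (hρ : ρ.IsRegular) {D : Type u}
    (hD : #D < ρ) (f : D → ρ.ord.ToType) : ∃ j, ∀ d, f d < j := by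
  by_contra! h
  have huniv : (⋃ d, Set.Iic (f d)) = Set.univ := by
    ext j
    simpa using h j
  have hlt : #(⋃ d, Set.Iic (f d)) < ρ := by
    rw [card_iUnion_lt_iff_forall_of_isRegular hρ hD]
    intro d
    rw [← Set.Iio_insert]
    exact (mk_insert_le).trans_lt (add_lt_of_lt hρ.aleph0_le (by simpa using mk_Iio_lt (f d) (by simp))
      (one_lt_aleph0.trans_le hρ.aleph0_le))
  rw [huniv, mk_univ, mk_ord_toType] at hlt
  exact hlt.false

theorem Cardinal.IsRegular.exists_subset_union_iUnion {ρ : Cardinal.{u}} (hρ : ρ.IsRegular)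
    {E : Type u} {C D : Set E} {Y : ρ.ord.ToType → Set E} (hD : #D < ρ)
    (hDY : D ⊆ C ∪ ⋃ i, Y i) : ∃ j, D ⊆ C ∪ ⋃ i : Set.Iio j, Y i.1 := by
  classical
  have hex : ∀ d : D, ∃ i, d.1 ∉ C → d.1 ∈ Y i := by
    intro d
    rcases hDY d.2 with h | h
    · obtain ⟨j, -⟩ := hρ.exists_forall_lt (D := PEmpty) (by simpa using hρ.pos) PEmpty.elim
      exact ⟨j, fun h' => absurd h h'⟩
    · obtain ⟨i, hi⟩ := Set.mem_iUnion.1 h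
      exact ⟨i, fun _ => hi⟩
  choose f hf using hex
  obtain ⟨j, hj⟩ := hρ.exists_forall_lt hD f
  refine ⟨j, fun d hd => ?_⟩
  by_cases hC : d ∈ C
  · exact Or.inl hC
  · exact Or.inr (Set.mem_iUnion.2 ⟨⟨f ⟨d, hd⟩, hj _⟩, hf ⟨d, hd⟩ hC⟩)

/-! ### Stretching long sequences of copies -/

namespace SortedStructure

open SortedLanguage

variable {L : SortedLanguage.{u}} {M : SortedStructure L} {κ : Cardinal.{u}} {P A : Set M.Elem}

theorem IsBigModel.exists_mk_copyType_le (hM : M.IsBigModel κ) (hP : #P < κ) (hA : #A < κ) :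
    ∃ ν < κ, ℵ₀ ≤ ν ∧ #(Σ n : ℕ, Set (Formula L (copySort P A (ULift.{u} (Fin n))))) ≤ ν := by
  obtain ⟨χ, hχ, hχ₀, hPA, -, hform⟩ := hM.exists_mk_formula_le (hM.add_lt hP hA)
  refine ⟨2 ^ χ, hM.two_power_lt hχ, hχ₀.trans (cantor χ).le, ?_⟩
  have : ∀ n : ℕ, #(Set (Formula L (copySort P A (ULift.{u} (Fin n))))) ≤ 2 ^ χ := by
    intro n
    rw [mk_set]
    refine power_le_power_left two_ne_zero (hform _ ?_)
    rw [mk_sum, mk_prod, lift_id, lift_id, lift_id, lift_id]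
    refine add_le_of_le hχ₀ (self_le_add_right _ _ |>.trans hPA) (mul_le_of_le hχ₀ ?_
      ((self_le_add_left _ _).trans hPA))
    exact (lt_aleph0_of_finite _).le.trans hχ₀
  rw [mk_sigma]
  refine (sum_le_sum _ (fun _ => 2 ^ χ) this).trans ?_
  simp only [sum_const, mk_nat, lift_aleph0]
  rw [lift_uzero]
  exact mul_le_of_le (hχ₀.trans (cantor χ).le) (hχ₀.trans (cantor χ).le) le_rfl

/-- A long sequence of copies of `A` has arbitrarily long finite subsequences whose types are
initial segments of the type of one indiscernible sequence. -/
theorem IsBigModel.exists_coherent_copyType (hM : M.IsBigModel κ) (hP : #P < κ) (hA : #A < κ) :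
    ∃ μ < κ, ∀ (I : Type u) [LinearOrder I] [WellFoundedLT I] (g : I → M.Auto), μ ≤ #I →
      ∃ τ : ∀ n, Set (Formula L (copySort P A (ULift.{u} (Fin n)))), ∀ N, ∃ F : Finset I,
        F.card = N ∧ ∀ (n : ℕ) (f : Fin n → I), StrictMono f → (∀ k, f k ∈ F) →
          copyType P A (fun k : ULift.{u} (Fin n) => g (f k.down)) = τ n := by
  classical
  obtain ⟨ν, hνκ, hν, hX⟩ := hM.exists_mk_copyType_le hP hA
  -- This is below `κ` because `κ` is a fixed point of the beth function.
  refine ⟨beth (ν.ord + (Order.succ ν).ord), ?_, ?_⟩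
  · conv_rhs => rw [← hM.beth_fixed]
    rw [beth_lt_beth]
    exact Ordinal.isPrincipal_add_ord hM.aleph0_lt.le (ord_lt_ord.2 hνκ)
      (ord_lt_ord.2 (hM.isStrongLimit.isSuccLimit.succ_lt hνκ))
  intro I _ _ g hI
  let T (n : ℕ) (F : Finset I) (hF : F.card = n) :
      Set (Formula L (copySort P A (ULift.{u} (Fin n)))) :=
    copyType P A fun k : ULift.{u} (Fin n) => g (F.orderEmbOfFin hF k.down)
  let c (F : Finset I) : Σ n : ℕ, Set (Formula L (copySort P A (ULift.{u} (Fin n)))) :=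
    ⟨F.card, T F.card F rfl⟩
  have hc : ∀ n F (hF : F.card = n), c F = ⟨n, T n F hF⟩ := by
    rintro n F rfl
    rfl
  obtain ⟨t, ht⟩ := exists_coherent_colours hν hX hI c
  choose F hF hFt using ht
  refine ⟨fun n => T n (F n) (hF n), fun N => ⟨F N, hF N, fun n f hf hfF => ?_⟩⟩
  have hH : (Finset.univ.image f).card = n := by
    rw [Finset.card_image_of_injective _ hf.injective, Finset.card_univ, Fintype.card_fin]
  have hHF : Finset.univ.image f ⊆ F N := by
    intro z hz
    obtain ⟨k, -, rfl⟩ := Finset.mem_image.1 hz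
    exact hfF k
  have h₁ : c (Finset.univ.image f) = t n := by rw [hFt N _ hHF, hH]
  have h₂ : c (F n) = t n := by rw [hFt n _ subset_rfl, hF]
  have h₃ := (hc n _ hH).symm.trans ((h₁.trans h₂.symm).trans (hc n _ (hF n)))
  have h₄ := eq_of_heq (Sigma.mk.inj h₃).2
  refine Eq.trans ?_ h₄
  have : f = (Finset.univ.image f).orderEmbOfFin hH :=
    Finset.orderEmbOfFin_unique hH (fun k => Finset.mem_image_of_mem f (Finset.mem_univ k)) hf
  change _ = copyType P A fun k : ULift.{u} (Fin n) =>
    g ((Finset.univ.image f).orderEmbOfFin hH k.down)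
  rw [← this]

/-- For every small linear order `J`, a long sequence of copies of `A` can be stretched to a family
indexed by `J`, every finite part of which is conjugate to a part of the given sequence. -/
theorem IsBigModel.exists_stretch (hM : M.IsBigModel κ) (hP : #P < κ) (hA : #A < κ) :
    ∃ μ < κ, ∀ (I : Type u) [LinearOrder I] [WellFoundedLT I] (g : I → M.Auto), μ ≤ #I →
      ∀ (J : Type u) [LinearOrder J], #J < κ → ∃ γ : J → M.Auto, ∀ G : Finset J,
        ∃ e : J → I, StrictMonoOn e G ∧ ∃ h : M.Auto, h.Fixes P ∧
          ∀ j ∈ G, ∀ a ∈ A, h.act ((g (e j)).act a) = (γ j).act a := by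
  classical
  obtain ⟨μ, hμ, H⟩ := hM.exists_coherent_copyType hP hA
  refine ⟨μ, hμ, fun I _ _ g hI J _ hJ => ?_⟩
  obtain ⟨τ, hτ⟩ := H I g hI
  have hembed : ∀ G : Finset J, ∃ e : J → I, StrictMonoOn e G ∧ ∀ (n : ℕ) (f : Fin n → J),
      StrictMono f → (∀ k, f k ∈ G) →
        copyType P A (fun k : ULift.{u} (Fin n) => g (e (f k.down))) = τ n := by
    intro G
    obtain ⟨F₁, hF₁, -⟩ := hτ 1
    obtain ⟨i₀, -⟩ := Finset.card_pos.1 (hF₁.symm ▸ Nat.one_pos)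
    obtain ⟨F, hF, h⟩ := hτ G.card
    let e : J → I := fun j =>
      if hj : j ∈ G then F.orderEmbOfFin hF ((G.orderIsoOfFin rfl).symm ⟨j, hj⟩) else i₀
    have he : StrictMonoOn e G := by
      intro j hj k hk hjk
      have hj' : j ∈ G := hj
      have hk' : k ∈ G := hk
      simp only [e, dif_pos hj', dif_pos hk', OrderEmbedding.lt_iff_lt, OrderIso.lt_iff_lt]
      exact hjk
    refine ⟨e, he, fun n f hf hfG => h n (e ∘ f) (fun k l hkl => he (hfG k) (hfG l) (hf hkl))
      fun k => ?_⟩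
    simp only [Function.comp, e, dif_pos (hfG k)]
    exact Finset.orderEmbOfFin_mem F hF _
  choose e he het using hembed
  -- Each finite `G` is contained in almost every index, so the limit type along `U` is decided on
  -- finite parts of `J`. Its realisation `y` gives the stretched family.
  let U : Ultrafilter (Finset J) := Ultrafilter.of Filter.atTop
  have hU : ∀ G : Finset J, ∀ᶠ G' in (U : Filter (Finset J)), G ⊆ G' := fun G =>
    Ultrafilter.of_le Filter.atTop (Filter.eventually_ge_atTop G)
  obtain ⟨y, hy⟩ := hM.saturated P (J × A) hP
    (by rw [mk_prod, lift_id, lift_id]; exact hM.mul_lt hJ hA)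
    (fun b => b.1.1) (fun a => a.2.1.1) (fun b => b.1.2)
    {φ | ∀ᶠ G in (U : Filter (Finset J)), φ ∈ copyType P A (g ∘ e G)} (by
      intro q hqp hq
      have := (hq.eventually_all (l := (U : Filter (Finset J)))).2 fun φ hφ => hqp hφ
      obtain ⟨G, hG⟩ := this.exists
      exact ⟨_, hG⟩)
  have hy' : ∀ φ : Formula L (copySort P A J), M.Sat φ (M.join (fun b => b.1.2) y) ↔
      ∀ᶠ G in (U : Filter (Finset J)), φ ∈ copyType P A (g ∘ e G) := by
    intro φ
    refine ⟨fun h => ?_, fun h => hy φ h⟩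
    by_contra hn
    exact hy φ.not (Ultrafilter.eventually_not.2 hn) h
  have key : ∀ G : Finset J, ∃ h : M.Auto, h.Fixes P ∧ ∀ j ∈ G, ∀ a : A,
      h.act ((g (e G j)).act a) = ⟨a.1.1, y (j, a)⟩ := by
    intro G
    let f : ULift.{u} (Fin G.card) → J := fun k => G.orderEmbOfFin rfl k.down
    have hf : ∀ k, G.orderEmbOfFin rfl k ∈ G := Finset.orderEmbOfFin_mem G rfl
    obtain ⟨h, hh⟩ := hM.homogeneous (P ⊕ (ULift.{u} (Fin G.card) × A))
      (mk_copyIndex_lt hM hP hA ((lt_aleph0_of_finite _).trans hM.aleph0_lt)) _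
      (copyVal P A fun k : ULift.{u} (Fin G.card) => g (e G (f k)))
      (M.join (fun b => b.1.2) fun a => y (f a.1, a.2)) (by
        intro φ
        rw [← sat_copyRelabel f φ y, hy']
        -- The type of the copies placed on `G` is `τ G.card` whichever larger `G'` is used to place
        -- them.
        have h₁ : ∀ G', G ⊆ G' →
            (copyRelabel P A f φ ∈ copyType P A (g ∘ e G') ↔ φ ∈ τ G.card) := by
          intro G' hG'
          rw [← het G' _ _ (G.orderEmbOfFin rfl).strictMono fun k => hG' (hf k)]
          exact sat_copyRelabel f φ _
        have h₂ : φ ∈ copyType P A (fun k : ULift.{u} (Fin G.card) => g (e G (f k))) ↔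
            φ ∈ τ G.card := by
          rw [← het G _ _ (G.orderEmbOfFin rfl).strictMono hf]
        refine h₂.trans ⟨fun h => ?_, fun h => ?_⟩
        · filter_upwards [hU G] with G' hG'
          exact (h₁ G' hG').2 h
        · obtain ⟨G', h, hG'⟩ := (h.and (hU G)).exists
          exact (h₁ G' hG').1 h)
    refine ⟨h, fun b hb => Sigma.ext rfl (heq_of_eq (hh (.inl ⟨b, hb⟩))), fun j hj a => ?_⟩
    have hk := hh (.inr (⟨(G.orderIsoOfFin rfl).symm ⟨j, hj⟩⟩, a))
    have hfj : f ⟨(G.orderIsoOfFin rfl).symm ⟨j, hj⟩⟩ = j := by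
      simp only [f, ← Finset.coe_orderIsoOfFin_apply, OrderIso.apply_symm_apply]
    have hk' : h.toEquiv _ ((g (e G (f ⟨(G.orderIsoOfFin rfl).symm ⟨j, hj⟩⟩))).toEquiv _ a.1.2) =
        y (f ⟨(G.orderIsoOfFin rfl).symm ⟨j, hj⟩⟩, a) := hk
    rw [hfj] at hk'
    exact Sigma.ext rfl (heq_of_eq hk')
  choose h hhP hh using key
  -- Singletons define the automorphisms; their effect on `A` is prescribed by `y`, so they agree
  -- there with those obtained from any larger `G`.
  refine ⟨fun j => (h {j}).comp (g (e {j} j)), fun G => ⟨e G, he G, h G, hhP G, fun j hj a ha => ?_⟩⟩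
  rw [hh G j hj ⟨a, ha⟩, Auto.act_comp, hh {j} j (Finset.mem_singleton_self j) ⟨a, ha⟩]

/-! ### Morley sequences and symmetry -/

namespace IsIndependenceRelation

variable {ind : Set M.Elem → Set M.Elem → Set M.Elem → Prop} {A B C : Set M.Elem}

/-- Existence of long Morley sequences. -/
theorem exists_independent_sequence (hM : M.IsBigModel κ) (hind : M.IsIndependenceRelation κ ind)
    (hA : #A < κ) (hB : #B < κ) (hC : #C < κ) (h : ind A C B)
    (I : Type u) [LinearOrder I] [WellFoundedLT I] (hI : #I < κ) :
    ∃ g : I → M.Auto, ∀ i, (g i).Fixes B ∧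
      ind ((g i).act '' A) C (B ∪ ⋃ j : Set.Iio i, (g j).act '' A) := by
  have hstep : ∀ (i : I) (f : Set.Iio i → M.Auto), ∃ g : M.Auto, g.Fixes B ∧
      ind (g.act '' A) C (B ∪ ⋃ j, (f j).act '' A) := by
    intro i f
    obtain ⟨g, hg, hgi⟩ := hind.extension A B C (B ∪ ⋃ j, (f j).act '' A) hA hB hC
      (hM.mk_union_lt hB (hM.mk_iUnion_lt ((mk_set_le _).trans_lt hI) hA
        fun j => ((f j).mk_image A).le)) h Set.subset_union_left
    exact ⟨g, hg.mono Set.subset_union_left, hgi⟩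
  choose s hs hs' using hstep
  let g : I → M.Auto := wellFounded_lt.fix fun i ih => s i fun j => ih j.1 j.2
  have hg : ∀ i, g i = s i fun j => g j := fun i => wellFounded_lt.fix_eq _ i
  refine ⟨g, fun i => ?_⟩
  have h₁ := hs i fun j => g j
  have h₂ := hs' i fun j => g j
  rw [← hg] at h₁ h₂
  exact ⟨h₁, h₂⟩

/-- Later terms are collected on the left in increasing order: by base monotonicity each new one is
independent from term `i` over `C` and those already collected, so `union_left` adds it. -/
theorem ind_iUnion_of_sequence (hM : M.IsBigModel κ) (hind : M.IsIndependenceRelation κ ind)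
    (hA : #A < κ) (hB : #B < κ) (hC : #C < κ) (hCB : C ⊆ B)
    {I : Type u} [LinearOrder I] (hI : #I < κ) {g : I → M.Auto}
    (hg : ∀ i, ind ((g i).act '' A) C (B ∪ ⋃ j : Set.Iio i, (g j).act '' A))
    (i : I) (F : Finset I) (hF : ∀ k ∈ F, i < k) :
    ind (⋃ k ∈ F, (g k).act '' A) C ((g i).act '' A) := by
  classical
  have hAg : ∀ k, #((g k).act '' A) < κ := fun k => by rwa [(g k).mk_image]
  have hU : ∀ k, #(⋃ j : Set.Iio k, (g j).act '' A) < κ := fun k =>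
    hM.mk_iUnion_lt ((mk_set_le _).trans_lt hI) hA fun j => ((g j).mk_image A).le
  have hsm : #(⋃ k, (g k).act '' A) < κ := hM.mk_iUnion_lt hI hA fun k => ((g k).mk_image A).le
  induction F using Finset.induction_on_max with
  | empty =>
    simp only [Finset.notMem_empty, Set.iUnion_false, Set.iUnion_empty]
    exact ind_of_forall_image_eq hM hind (hM.mk_lt_of_finite Set.finite_empty) hC (hAg i)
      fun g _ => Set.image_empty _
  | insert m F hm ih =>
    have hF' := ih fun k hk => hF k (Finset.mem_insert_of_mem hk)
    have hFs : #(⋃ k ∈ F, (g k).act '' A : Set M.Elem) < κ :=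
      (mk_le_mk_of_subset (Set.iUnion₂_subset fun k _ =>
        Set.subset_iUnion (fun k => (g k).act '' A) k)).trans_lt hsm
    have hsub : ⋃ k ∈ F, (g k).act '' A ⊆ ⋃ j : Set.Iio m, (g j).act '' A :=
      Set.iUnion₂_subset fun k hk =>
        Set.subset_iUnion (fun j : Set.Iio m => (g j).act '' A) ⟨k, hm k hk⟩
    have h₁ := hind.base_monotonicity _ _ (C ∪ ⋃ k ∈ F, (g k).act '' A) _ (hAg m)
      (hM.mk_union_lt hB (hU m)) Set.subset_union_left (Set.union_subset_union hCB hsub) (hg m)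
    have h₂ := hind.monotonicity _ _ _ _ ((g i).act '' A) (hAg m) (hM.mk_union_lt hB (hU m))
      (hM.mk_union_lt hC hFs) h₁ subset_rfl (Set.subset_union_of_subset_right
        (Set.subset_iUnion (fun j : Set.Iio m => (g j).act '' A)
          ⟨i, hF m (Finset.mem_insert_self _ _)⟩) _)
    have := union_left hM hind hFs (hAg m) hC (hAg i) hF' h₂
    rwa [Finset.set_biUnion_insert, Set.union_comm]

/-- Existence of Morley sequences in the reverse of a given order: every element of the sequence is
on the right hand side, with the preceding elements on the left hand side. -/
theorem exists_reverse_independent_family (hM : M.IsBigModel κ)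
    (hind : M.IsIndependenceRelation κ ind) (hA : #A < κ) (hB : #B < κ) (hC : #C < κ)
    (h : ind A C B) (hCB : C ⊆ B) (T : Type u) [LinearOrder T] (hT : #T < κ) :
    ∃ γ : T → M.Auto, ∀ j, (γ j).Fixes B ∧
      ind (⋃ k : Set.Iio j, (γ k.1).act '' A) C ((γ j).act '' A) := by
  classical
  obtain ⟨μ, hμ, H⟩ := hM.exists_stretch hB hA
  obtain ⟨I, _, _, hIμ⟩ : ∃ (I : Type u) (_ : LinearOrder I) (_ : WellFoundedLT I), #I = μ :=
    ⟨μ.ord.ToType, inferInstance, inferInstance, mk_ord_toType μ⟩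
  have hI : #I < κ := hIμ.trans_lt hμ
  obtain ⟨g, hg⟩ := exists_independent_sequence hM hind hA hB hC h I hI
  obtain ⟨γ₀, hγ₀⟩ := H I g hIμ.ge Tᵒᵈ hT
  choose e he k hk hke using hγ₀
  -- The stretched automorphisms `γ₀` are controlled only on `A`; these agree with them there and
  -- also fix `B`.
  let γ : T → M.Auto := fun j => (k {OrderDual.toDual j}).comp
    (g (e {OrderDual.toDual j} (OrderDual.toDual j)))
  have hγ : ∀ j, ∀ a ∈ A, (γ₀ (OrderDual.toDual j)).act a = (γ j).act a := fun j a ha =>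
    (hke _ _ (Finset.mem_singleton_self _) a ha).symm
  have hγB : ∀ j, (γ j).Fixes B := fun j => (hk _).comp (hg _).1
  have hYs : ∀ j, #((γ j).act '' A) ≤ #A := fun j => ((γ _).mk_image A).le
  have hYU : #(⋃ j, (γ j).act '' A) < κ := hM.mk_iUnion_lt hT hA hYs
  have hgU : #(⋃ i, (g i).act '' A) < κ := hM.mk_iUnion_lt hI hA fun i => ((g i).mk_image A).le
  have hfin : ∀ (j : T) (G : Finset T), (∀ k ∈ G, k < j) →
      ind (⋃ k ∈ G, (γ k).act '' A) C ((γ j).act '' A) := by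
    intro j G hG
    let G' : Finset Tᵒᵈ := (insert j G).map OrderDual.toDual.toEmbedding
    have hmem : ∀ l ∈ insert j G, OrderDual.toDual l ∈ G' := fun l hl =>
      Finset.mem_map_of_mem _ hl
    have hYe : ∀ l ∈ insert j G,
        (k G').act '' ((g (e G' (OrderDual.toDual l))).act '' A) = (γ l).act '' A := by
      intro l hl
      rw [← Auto.image_comp]
      exact Auto.image_eq_of_act_eq fun a ha => (hke _ _ (hmem l hl) a ha).trans (hγ l a ha)
    have h₁ := ind_iUnion_of_sequence hM hind hA hB hC hCB hI
      (fun i => (hg i).2) (e G' (OrderDual.toDual j)) (G.image fun l => e G' (OrderDual.toDual l))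
      (by
        intro i hi
        obtain ⟨l, hl, rfl⟩ := Finset.mem_image.1 hi
        exact he G' (hmem j (Finset.mem_insert_self _ _)) (hmem l (Finset.mem_insert_of_mem hl))
          (OrderDual.toDual_lt_toDual.2 (hG l hl)))
    rw [Finset.set_biUnion_finset_image] at h₁
    have h₂ := hind.invariance _ _ _ ((mk_le_mk_of_subset (Set.iUnion₂_subset fun l _ =>
      Set.subset_iUnion (fun i => (g i).act '' A) (e G' (OrderDual.toDual l)))).trans_lt hgU)
      (by rwa [(g _).mk_image]) hC (k G') h₁
    rw [((hk G').mono hCB).image_eq, hYe j (Finset.mem_insert_self _ _), Set.image_iUnion₂,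
      Set.iUnion₂_congr fun l hl => hYe l (Finset.mem_insert_of_mem hl)] at h₂
    exact h₂
  refine ⟨γ, fun j => ⟨hγB j, ?_⟩⟩
  have hYj : #((γ j).act '' A) < κ := (hYs j).trans_lt hA
  have hEU : ⋃ k : Set.Iio j, (γ k.1).act '' A ⊆ ⋃ j, (γ j).act '' A :=
    Set.iUnion_subset fun i => Set.subset_iUnion (fun j => (γ j).act '' A) i.1
  have hEs : #(⋃ k : Set.Iio j, (γ k.1).act '' A) < κ := (mk_le_mk_of_subset hEU).trans_lt hYU
  refine hind.finite_character _ _ _ hEs hYj hC fun A₀ hA₀ hfin₀ => ?_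
  obtain ⟨G, hG⟩ := Set.Finite.exists_finset_subset_biUnion hfin₀ hA₀
  have hsub : ⋃ k ∈ G, (γ k.1).act '' A ⊆
      ⋃ k ∈ G.map (Function.Embedding.subtype _), (γ k).act '' A := by
    refine Set.iUnion₂_subset fun k hk => ?_
    exact Set.subset_biUnion_of_mem (u := fun k => (γ k).act '' A)
      (Finset.mem_map_of_mem (Function.Embedding.subtype _) hk)
  have hind' := hfin j (G.map (Function.Embedding.subtype _)) (by
    intro k hk
    obtain ⟨k, -, rfl⟩ := Finset.mem_map.1 hk
    exact k.2)
  refine hind.monotonicity _ _ _ _ _ ?_ hYj hC hind' (hG.trans hsub) subset_rfl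
  exact (mk_le_mk_of_subset (Set.iUnion₂_subset fun k _ =>
    Set.subset_iUnion (fun j => (γ j).act '' A) k)).trans_lt hYU

/-- Every independence relation is symmetric. -/
theorem symm (hM : M.IsBigModel κ) (hind : M.IsIndependenceRelation κ ind)
    (hA : #A < κ) (hB : #B < κ) (hC : #C < κ) (h : ind A C B) : ind B C A := by
  have hP := hM.mk_union_lt hB hC
  replace h := union_base_right hM hind hA hC hB h
  obtain ⟨β, hβκ, hβ⟩ := hind.exists_localBound hB
  -- A regular length above `β` confines every base for `B` to `C` and an initial segment of the
  -- sequence.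
  obtain ⟨ρ, hρκ, hρ, hβρ⟩ : ∃ ρ < κ, ρ.IsRegular ∧ β < ρ :=
    ⟨Order.succ (max β ℵ₀), hM.isStrongLimit.isSuccLimit.succ_lt (max_lt hβκ hM.aleph0_lt),
      isRegular_succ (le_max_right _ _), Order.lt_succ_of_le (le_max_left _ _)⟩
  have hT : #ρ.ord.ToType < κ := (mk_ord_toType ρ).trans_lt hρκ
  obtain ⟨γ, hγ⟩ := exists_reverse_independent_family hM hind hA hP hC h Set.subset_union_right
    ρ.ord.ToType hT
  generalize hY : (fun j => (γ j).act '' A) = Y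
  have hYγ : ∀ j, (γ j).act '' A = Y j := fun j => congrFun hY j
  have hYs : ∀ j, #(Y j) ≤ #A := fun j => by rw [← hYγ, (γ j).mk_image]
  have hYU : #(⋃ j, Y j) < κ := hM.mk_iUnion_lt hT hA hYs
  have hX := hM.mk_union_lt hC hYU
  obtain ⟨D, hD, hDβ, hBD⟩ := hβ (C ∪ ⋃ j, Y j) hX
  obtain ⟨j, hj⟩ := hρ.exists_subset_union_iUnion (hDβ.trans_lt hβρ) hD
  have hsub : ⋃ i : Set.Iio j, Y i.1 ⊆ ⋃ j, Y j :=
    Set.iUnion_subset fun i => Set.subset_iUnion Y i.1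
  have hEs : #(⋃ i : Set.Iio j, Y i.1) < κ := (mk_le_mk_of_subset hsub).trans_lt hYU
  have hYj : #(Y j) < κ := (hYs j).trans_lt hA
  have h₁ : ind (⋃ i : Set.Iio j, Y i.1) C (Y j) := by
    have := (hγ j).2
    simp only [hYγ] at this
    exact this
  -- Local character puts `B` on the left of a term `Y j`, over the preceding terms; `h₁` removes
  -- those terms from the base.
  have h₂ : ind B (C ∪ ⋃ i : Set.Iio j, Y i.1) (Y j) :=
    hind.monotonicity _ _ _ _ _ hB hX (hM.mk_union_lt hC hEs)
      (hind.base_monotonicity _ _ _ _ hB hX hj (Set.union_subset_union_right _ hsub) hBD)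
      subset_rfl (Set.subset_union_of_subset_right (Set.subset_iUnion Y j) _)
  have h₃ : ind B C (Y j) := hind.monotonicity _ _ _ _ _ (hM.mk_union_lt hEs hB) hYj hC
    (union_left hM hind hEs hB hC hYj h₁ h₂) Set.subset_union_right subset_rfl
  refine hind.of_image hB hA hC (γ j) ?_
  rwa [hYγ, ((hγ j).1.mono Set.subset_union_left).image_eq,
    ((hγ j).1.mono Set.subset_union_right).image_eq]

end IsIndependenceRelation

end SortedStructure

/-! ### Saturated families and the converse direction -/

namespace SortedStructure

open SortedLanguage

variable {L : SortedLanguage.{u}} {M : SortedStructure L} {κ : Cardinal.{u}}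

/-- There is a small family of copies of `A` which is saturated: for every part of it indexed by `O`
and every copy of `A`, there is a sequence in the family, indexed by `ι`, of realisations of the type
of this copy over `P`, the given part and the preceding elements of the sequence. -/
theorem IsBigModel.exists_saturated_family (hM : M.IsBigModel κ) {P A : Set M.Elem} (hP : #P < κ)
    (hA : #A < κ) {O ι : Type u} [LinearOrder ι] [WellFoundedLT ι] (hO : #O < κ) (hι : #ι < κ) :
    ∃ (W : Type u) (ev : W → M.Auto), #W < κ ∧ Nonempty W ∧ ∀ (d : O → W) (g : M.Auto),
      ∃ a : ι → W, ∀ i, ∃ h : M.Auto, h.Fixes P ∧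
        (∀ k, ∀ x ∈ A, h.act ((ev (d k)).act x) = (ev (d k)).act x) ∧
        (∀ j < i, ∀ x ∈ A, h.act ((ev (a j)).act x) = (ev (a j)).act x) ∧
        ∀ x ∈ A, h.act (g.act x) = (ev (a i)).act x := by
  classical
  obtain ⟨χ, hχκ, hχ, hle, -, hform⟩ := hM.exists_mk_formula_le
    (hM.add_lt (hM.add_lt hP hA) (hM.add_lt hO hι))
  have hPχ : #P ≤ χ := le_trans (le_self_add.trans le_self_add) hle
  have hAχ : #A ≤ χ := le_trans (le_add_self.trans le_self_add) hle
  have hOχ : #O ≤ χ := le_trans (le_self_add.trans le_add_self) hle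
  have hιχ : #ι ≤ χ := le_trans (le_add_self.trans le_add_self) hle
  have h1χ : 1 ≤ χ := one_le_aleph0.trans hχ
  have hχ2 : ℵ₀ ≤ (2 : Cardinal.{u}) ^ χ := hχ.trans (cantor χ).le
  have hOi : ∀ i : ι, #(O ⊕ Set.Iio i) ≤ χ := fun i => by
    rw [mk_sum, lift_id, lift_id]
    exact add_le_of_le hχ hOχ ((mk_set_le _).trans hιχ)
  let K : ι → Type u := fun i => Option (O ⊕ Set.Iio i)
  have hK : ∀ i, #(K i) ≤ χ := fun i => by
    rw [mk_option]
    exact add_le_of_le hχ (hOi i) h1χ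
  -- A label prescribes the type of a new copy over the copies named by the children; `none`
  -- provides a leaf, so that the family is nonempty.
  let N := Option (Σ i : ι, Set (Formula L (copySort P A (K i))))
  let ar : N → Type u := fun s => match s with
    | none => PEmpty
    | some s => O ⊕ Set.Iio s.1
  let F {i : ι} (z : O ⊕ Set.Iio i → M.Auto) (g : M.Auto) : K i → M.Auto := fun k => k.elim g z
  let ev : WType ar → M.Auto := WType.elim M.Auto fun s => match s with
    | ⟨none, _⟩ => Auto.refl M
    | ⟨some s, z⟩ => if h : ∃ g, copyType P A (F z g) = s.2 then h.choose else Auto.refl M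
  have hev : ∀ (i : ι) (z : O ⊕ Set.Iio i → WType ar) (g : M.Auto),
      copyType P A (F (ev ∘ z) (ev ⟨some ⟨i, copyType P A (F (ev ∘ z) g)⟩, z⟩)) =
        copyType P A (F (ev ∘ z) g) := by
    intro i z g
    have hex : ∃ g', copyType P A (F (ev ∘ z) g') = copyType P A (F (ev ∘ z) g) := ⟨g, rfl⟩
    have : ev ⟨some ⟨i, copyType P A (F (ev ∘ z) g)⟩, z⟩ = hex.choose := dif_pos hex
    rw [this]
    exact hex.choose_spec
  have hW : #(WType ar) ≤ 2 ^ χ := by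
    refine mk_wType_le_two_power hχ ?_ fun s => ?_
    · rw [mk_option, mk_sigma]
      refine add_le_of_le hχ2 ((sum_le_sum _ (fun _ => 2 ^ χ) fun i => ?_).trans ?_)
        (one_le_aleph0.trans hχ2)
      · rw [mk_set]
        refine power_le_power_left two_ne_zero (hform _ ?_)
        rw [mk_sum, mk_prod, lift_id, lift_id, lift_id, lift_id]
        exact add_le_of_le hχ hPχ (mul_le_of_le hχ (hK i) hAχ)
      · rw [sum_const']
        exact mul_le_of_le hχ2 (hιχ.trans (cantor χ).le) le_rfl
    · rcases s with _ | s
      · simp [ar]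
      · exact hOi s.1
  refine ⟨WType ar, ev, hW.trans_lt (hM.two_power_lt hχκ), ⟨⟨none, PEmpty.elim⟩⟩, fun d g => ?_⟩
  let z (i : ι) (ih : ∀ j, j < i → WType ar) : O ⊕ Set.Iio i → WType ar :=
    Sum.elim d fun j => ih j.1 j.2
  -- Codes are closed under prescribing a type over earlier codes, so the whole sequence is built
  -- inside the family.
  let a : ι → WType ar := wellFounded_lt.fix fun i ih =>
    ⟨some ⟨i, copyType P A (F (ev ∘ z i ih) g)⟩, z i ih⟩
  have ha : ∀ i, a i = ⟨some ⟨i, copyType P A (F (ev ∘ z i fun j _ => a j) g)⟩,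
    z i fun j _ => a j⟩ := fun i => wellFounded_lt.fix_eq _ i
  refine ⟨a, fun i => ?_⟩
  have h₁ := hev i (z i fun j _ => a j) g
  rw [← ha] at h₁
  obtain ⟨h, hP, hh⟩ := exists_auto_of_copyType_eq hM hP hA ((hK i).trans_lt hχκ) h₁.symm
  exact ⟨h, hP, fun k => hh (some (.inl k)), fun j hj => hh (some (.inr ⟨j, hj⟩)), hh none⟩

/-- If each `Y i` is M-dividing independent from `D` and the preceding sets, then their union is
algebraically independent from `D`. -/
theorem acl_iUnion_inter_acl_subset {ι : Type u} [LinearOrder ι] {C D : Set M.Elem}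
    {Y : ι → Set M.Elem}
    (h : ∀ (i : ι) (F : Finset ι), (∀ k ∈ F, k < i) →
      M.acl (Y i ∪ (C ∪ ⋃ k ∈ F, Y k)) ∩ M.acl D ⊆ M.acl (C ∪ ⋃ k ∈ F, Y k)) (S : Set ι) :
    M.acl (C ∪ ⋃ i : S, Y i.1) ∩ M.acl D ⊆ M.acl C := by
  classical
  have hfin : ∀ F : Finset ι, M.acl (C ∪ ⋃ k ∈ F, Y k) ∩ M.acl D ⊆ M.acl C := by
    intro F
    induction F using Finset.induction_on_max with
    | empty => simp
    | insert m F hm ih =>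
      rintro e ⟨he, heD⟩
      -- The hypothesis, used at the greatest index, discards that set while `e` stays in `acl D`.
      refine ih ⟨h m F hm ⟨?_, heD⟩, heD⟩
      rwa [Finset.set_biUnion_insert, Set.union_left_comm] at he
  rintro e ⟨he, heD⟩
  obtain ⟨Z, hZ, hZf, he⟩ := exists_finite_of_mem_acl he
  obtain ⟨F, hF⟩ := (hZf.sdiff (t := C)).exists_finset_subset_biUnion
    (Y := fun i : S => Y i.1) fun x hx => (hZ hx.1).resolve_left hx.2
  refine hfin (F.map (Function.Embedding.subtype _)) ⟨acl_mono (fun x hx => ?_) he, heD⟩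
  by_cases hC : x ∈ C
  · exact Or.inl hC
  · obtain ⟨k, hk, hx⟩ := Set.mem_iUnion₂.1 (hF ⟨hx, hC⟩)
    exact Or.inr (Set.mem_biUnion (Finset.mem_map_of_mem (Function.Embedding.subtype _) hk) hx)

theorem exists_cover_of_mk_le {E O W : Type u} [Nonempty W] {P D : Set E} {Y : W → Set E}
    (hD : D ⊆ P ∪ ⋃ w, Y w) (hDO : #D ≤ #O) : ∃ d : O → W, D ⊆ P ∪ ⋃ k, Y (d k) := by
  obtain ⟨i⟩ := hDO
  have hex : ∀ x : D, ∃ w, x.1 ∉ P → x.1 ∈ Y w := by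
    intro x
    rcases hD x.2 with h | h
    · exact ⟨Classical.arbitrary W, fun h' => absurd h h'⟩
    · obtain ⟨w, hw⟩ := Set.mem_iUnion.1 h
      exact ⟨w, fun _ => hw⟩
  choose w hw using hex
  refine ⟨Function.extend i w fun _ => Classical.arbitrary W, fun x hx => ?_⟩
  by_cases hP : x ∈ P
  · exact Or.inl hP
  · refine Or.inr (Set.mem_iUnion.2 ⟨i ⟨x, hx⟩, ?_⟩)
    rw [i.injective.extend_apply]
    exact hw ⟨x, hx⟩ hP

open IsIndependenceRelation in
theorem IsCanonicalIndependenceRelation.ind_of_thornIndep (hM : M.IsBigModel κ)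
    {ind : Set M.Elem → Set M.Elem → Set M.Elem → Prop}
    (hind : M.IsCanonicalIndependenceRelation κ ind) {A B C : Set M.Elem} (hA : #A < κ)
    (hB : #B < κ) (hC : #C < κ) (h : M.ThornIndep κ A C B) : ind A C B := by
  have hI := hind.toIsIndependenceRelation
  have hP := hM.mk_union_lt hB hC
  generalize hPdef : B ∪ C = P at hP
  have hCP : C ⊆ P := hPdef ▸ Set.subset_union_right
  have hBP : B ⊆ P := hPdef ▸ Set.subset_union_left
  obtain ⟨μA, hμA, hLA⟩ := hI.exists_localBound hA
  obtain ⟨μP, hμP, hLP⟩ := hI.exists_localBound hP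
  have hmono : ∀ {X : Set M.Elem} {μ ν : Cardinal.{u}}, μ ≤ ν → LocalBound κ ind X μ →
      LocalBound κ ind X ν := by
    intro X μ ν hle hX Z hZ
    obtain ⟨Z₀, h₁, h₂, h₃⟩ := hX Z hZ
    exact ⟨Z₀, h₁, h₂.trans hle, h₃⟩
  obtain ⟨μ, hμκ, hμ, hμA', hμP'⟩ : ∃ μ < κ, ℵ₀ ≤ μ ∧ μA ≤ μ ∧ μP ≤ μ :=
    ⟨max ℵ₀ (max μA μP), max_lt hM.aleph0_lt (max_lt hμA hμP), by simp, by simp, by simp⟩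
  have hρ : (Order.succ μ).IsRegular := isRegular_succ hμ
  have hρκ : Order.succ μ < κ := hM.isStrongLimit.isSuccLimit.succ_lt hμκ
  have hμρ : μ < Order.succ μ := Order.lt_succ μ
  generalize Order.succ μ = ρ at hρ hρκ hμρ
  have hι : #ρ.ord.ToType < κ := (mk_ord_toType ρ).trans_lt hρκ
  obtain ⟨O, rfl⟩ : ∃ O : Type u, #O = μ := ⟨μ.out, mk_out μ⟩
  -- The family is fixed before the base `D` is known, hence it must serve every choice of `O`-many
  -- of its members.
  obtain ⟨W, ev, hW, _, hfam⟩ := hM.exists_saturated_family hP hA hμκ hι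
  have hevA : ∀ w, #((ev w).act '' A) ≤ #A := fun w => ((ev w).mk_image A).le
  let H : Set M.Elem := P ∪ ⋃ w, (ev w).act '' A
  have hH : #H < κ := hM.mk_union_lt hP (hM.mk_iUnion_lt hW hA hevA)
  obtain ⟨g, hg, hgM⟩ := h H hH (hBP.trans Set.subset_union_left)
  rw [hPdef] at hg
  have hgA : #(g.act '' A) < κ := by rwa [g.mk_image]
  obtain ⟨D₀, hD₀, hD₀μ, hD₀i⟩ := hI.localBound_image hA (hmono hμA' hLA) g H hH
  -- The base is enlarged to `P` and whole copies of `A`: an arbitrary set of size at most `#O` need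
  -- not have local character bounded by `#O`, but a union of at most that many copies does.
  obtain ⟨d, hd⟩ := exists_cover_of_mk_le hD₀ hD₀μ
  obtain ⟨a, ha⟩ := hfam d g
  choose k hkP hkd hka hkg using ha
  have hDU : #(⋃ o, (ev (d o)).act '' A) < κ := hM.mk_iUnion_lt hμκ hA fun o => hevA _
  have hDH : P ∪ ⋃ o, (ev (d o)).act '' A ⊆ H := Set.union_subset_union_right _
    (Set.iUnion_subset fun o => Set.subset_iUnion (fun w => (ev w).act '' A) (d o))
  have hkD : ∀ i, (k i).Fixes (P ∪ ⋃ o, (ev (d o)).act '' A) := by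
    rintro i x (hx | hx)
    · exact hkP i x hx
    · obtain ⟨o, x', hx', rfl⟩ := Set.mem_iUnion.1 hx
      exact hkd i o x' hx'
  have hLD : LocalBound κ ind (P ∪ ⋃ o, (ev (d o)).act '' A) #O :=
    localBound_union hM hI hP hDU hμ (hmono hμP' hLP)
      (localBound_iUnion hM hI hA (fun o => hevA (d o)) hμ hμκ le_rfl
        (mk_ne_zero_iff.1 (aleph0_pos.trans_le hμ).ne')
        fun o => hI.localBound_image hA (hmono hμA' hLA) (ev (d o)))
  have hPD : P ⊆ P ∪ ⋃ o, (ev (d o)).act '' A := Set.subset_union_left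
  have hDs := hM.mk_union_lt hP hDU
  generalize (P ∪ ⋃ o, (ev (d o)).act '' A) = D at hd hDH hkD hLD hPD hDs
  have hCD := hCP.trans hPD
  have hDi : ind (g.act '' A) D H := hI.base_monotonicity _ _ _ _ hgA hH hd hDH hD₀i
  generalize hYdef : (fun i => (ev (a i)).act '' A) = Y
  have hYH : ∀ i, Y i ⊆ H := fun i => by
    rw [← hYdef]
    exact Set.subset_union_of_subset_right
      (Set.subset_iUnion (fun w => (ev w).act '' A) (a i)) _
  have hYA : ∀ i, #(Y i) ≤ #A := fun i => by
    rw [← hYdef]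
    exact hevA _
  have hYk : ∀ i, (k i).act '' (g.act '' A) = Y i := fun i => by
    rw [← hYdef, ← Auto.image_comp]
    exact Auto.image_eq_of_act_eq fun x hx => hkg i x hx
  have hkY : ∀ i, ∀ j < i, (k i).Fixes (Y j) := by
    intro i j hj x hx
    rw [← hYdef] at hx
    obtain ⟨x, hx, rfl⟩ := hx
    exact hka i j hj x hx
  have hYU : #(⋃ i, Y i) < κ := hM.mk_iUnion_lt hι hA hYA
  have hacl : ∀ S : Set ρ.ord.ToType,
      M.acl (C ∪ ⋃ i : S, Y i.1) ∩ M.acl D ⊆ M.acl C := by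
    refine acl_iUnion_inter_acl_subset fun i F hF => ?_
    generalize hC' : (C ∪ ⋃ j ∈ F, Y j) = C'
    have hCC' : C ⊆ C' := hC' ▸ Set.subset_union_left
    have hC'H : C' ⊆ H := by
      rw [← hC']
      exact Set.union_subset (hCD.trans hDH) (Set.iUnion₂_subset fun j _ => hYH j)
    have hC's : #C' < κ := (mk_le_mk_of_subset hC'H).trans_lt hH
    have hfix : (k i).Fixes C' := by
      rw [← hC']
      rintro x (hx | hx)
      · exact hkD i x (hCD hx)
      · obtain ⟨j, hj, hx⟩ := Set.mem_iUnion₂.1 hx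
        exact hkY i j (hF j hj) x hx
    rintro e ⟨he, heD⟩
    -- Pulling back by `k i` replaces `Y i` by the M-independent copy `g.act '' A`, fixes `C'`
    -- pointwise and keeps `e` in the closure of `D`, hence of `H`.
    have h₁ : (k i).symm.act e ∈ M.acl (g.act '' A ∪ C') := by
      have := act_mem_acl hM (hM.mk_union_lt ((hYA i).trans_lt hA) hC's) (k i).symm he
      rwa [Set.image_union, ← hYk, Auto.image_symm_image, hfix.symm.image_eq] at this
    have h₂ : (k i).symm.act e ∈ M.acl (H ∪ C') := by
      have := act_mem_acl hM hDs (k i).symm heD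
      rw [(hkD i).symm.image_eq] at this
      exact acl_mono (hDH.trans Set.subset_union_left) this
    have h₃ : (k i).symm.act e ∈ M.acl C' := by
      rw [← hgM C' hCC' (hC'H.trans (Set.subset_union_left.trans (subset_acl _)))]
      exact ⟨h₁, h₂⟩
    have := act_mem_acl hM hC's (k i) h₃
    rwa [Auto.act_act_symm, hfix.image_eq] at this
  have hX := hM.mk_union_lt hC hYU
  obtain ⟨D', hD', hD'μ, hDD'⟩ := hLD (C ∪ ⋃ i, Y i) hX
  obtain ⟨i, hi⟩ := hρ.exists_subset_union_iUnion (hD'μ.trans_lt hμρ) hD'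
  have hYi : #(Y i) < κ := (hYA i).trans_lt hA
  generalize hEdef : C ∪ ⋃ j : Set.Iio i, Y j.1 = E at hi
  have hCE : C ⊆ E := hEdef ▸ Set.subset_union_left
  have hEX : E ⊆ C ∪ ⋃ i, Y i := by
    rw [← hEdef]
    exact Set.union_subset_union_right _ (Set.iUnion_subset fun j => Set.subset_iUnion Y j.1)
  have hEH : E ⊆ H := hEX.trans (Set.union_subset (hCD.trans hDH) (Set.iUnion_subset hYH))
  have hEs : #E < κ := (mk_le_mk_of_subset hEX).trans_lt hX
  have hkE : (k i).Fixes E := by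
    rw [← hEdef]
    rintro x (hx | hx)
    · exact hkD i x (hCD hx)
    · obtain ⟨j, hx⟩ := Set.mem_iUnion.1 hx
      exact hkY i j j.2 x hx
  have hDE := hM.mk_union_lt hDs hEs
  have h₁ : ind (Y i) D (D ∪ E) := by
    have := hI.monotonicity _ _ _ _ (D ∪ E) hgA hH hDs hDi subset_rfl (Set.union_subset hDH hEH)
    have := hI.invariance _ _ _ hgA hDE hDs (k i) this
    rwa [hYk, (hkD i).image_eq, Set.image_union, (hkD i).image_eq, hkE.image_eq] at this
  -- `D` is independent from `C ∪ ⋃ i, Y i` over `E`; symmetry turns this into a statement with `Y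
  -- i` on the left.
  have h₂ : ind (Y i) E (D ∪ E) := by
    have := hI.base_monotonicity _ _ E _ hDs hX hi hEX hDD'
    have := hI.normality _ _ _ hDs hX hEs this
    have := hI.monotonicity _ _ _ _ (Y i) hDE hX hEs this subset_rfl
      (Set.subset_union_of_subset_right (Set.subset_iUnion Y i) _)
    exact hI.symm hM hDE hYi hEs this
  have h₃ := hind.intersection _ _ _ _ hYi hDE Set.subset_union_left Set.subset_union_right h₁ h₂
  have haclC : M.acl D ∩ M.acl E = M.acl C := by
    refine Set.Subset.antisymm (fun e he => hacl (Set.Iio i) ⟨?_, he.1⟩)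
      (Set.subset_inter (acl_mono hCD) (acl_mono hCE))
    rw [hEdef]
    exact he.2
  rw [haclC, ← Set.union_eq_self_of_subset_left (subset_acl C)] at h₃
  have hCs := mk_acl_lt hM hC
  -- `acl C` is independent from everything over `C`, so the base `acl C` can be lowered to `C`.
  have h₄ := union_left hM hI hCs hYi hC hDE
    (ind_of_forall_image_eq hM hI hCs hC hDE fun g hg => hg.image_acl hM hC) h₃
  have h₅ : ind (Y i) C B := hI.monotonicity _ _ _ _ _ (hM.mk_union_lt hCs hYi) hDE hC h₄
    Set.subset_union_right (hBP.trans (hPD.trans Set.subset_union_left))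
  have hkg' : ((k i).comp g).Fixes P := (hkP i).comp hg
  refine hI.of_image hA hB hC ((k i).comp g) ?_
  rwa [Auto.image_comp, hYk, (hkg'.mono hBP).image_eq, (hkg'.mono hCP).image_eq]

end SortedStructure

theorem mainTheorem9 (L : SortedLanguage.{u}) (M : SortedStructure L) (κ : Cardinal.{u})
    (hM : M.IsBigModel κ)
    (ind : Set M.Elem → Set M.Elem → Set M.Elem → Prop)
    (hind : M.IsCanonicalIndependenceRelation κ ind) :
    ∀ A B C : Set M.Elem, #A < κ → #B < κ → #C < κ →
      (ind A C B ↔ M.ThornIndep κ A C B) := by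
  intro A B C hA hB hC
  exact ⟨hind.toIsStrictIndependenceRelation.thornIndep hM hA hC hB,
    hind.ind_of_thornIndep hM hA hB hC⟩
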